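/- Let $\xi$ be a random variable with law $\mu$, let $f(\cdot;\xi):\mathbb R^n\to\mathbb R$ be such that $f(x;\cdot)$ is integrable for every $x$, and put $F(x)=\mathbb E_\xi[f(x;\xi)]$. Let $r:\mathbb R^n\to\mathbb R\cup\{+\infty\}$ be closed and convex, $\phi=F+r$, and $\phi^*=\inf\phi>-\infty$. For a function $h$, $\partial h(x)$ denotes the set of all $v$ with $h(y)\ge h(x)+\langle v,y-x\rangle+o(\|y-x\|)$ as $y\to x$; for $c>0$, $\mathrm{prox}_{cr}(z)=\arg\min_y\{r(y)+\frac1{2c}\|y-z\|^2\}$; and for $\lambda>0$, $\phi_\lambda(x)=\inf_y\{\phi(y)+\frac1{2\lambda}\|y-x\|^2\}$ is the Moreau envelope of $\phi$. Assumptions. (1) $F$ is $\rho$-weakly convex with $\rho>0$, i.e. $F+\frac\rho2\|\cdot\|^2$ is convex. (2) For each $k$, $\tilde\nabla_k f(x;\xi)$ is a jointly measurable choice of sample subgradients, $\tilde\nabla_k f(x;\xi)\in\partial f(x;\xi)$ for all $x\in\mathrm{dom}(r)$ and almost every $\xi$, which is unbiased: $\mathbb E_\xi[\tilde\nabla_k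 f(x;\xi)]\in\partial F(x)$ for all $x\in\mathrm{dom}(r)$. (3) There is $M\ge0$ such that $\mathbb E_\xi\|s(\xi)\|^2\le M^2$ for all $x\in\mathrm{dom}(r)$ and all measurable $s$ with $s(\xi)\in\partial f(x;\xi)$ for almost every $\xi$. (4) There are an integer $\tau\ge0$ and probabilities $p_0,\dots,p_\tau$ summing to $1$ with $\mathrm{Prob}(\tau_k=j)=p_j$ for all $k$ and all $j=0,\dots,\tau$. The samples $\xi_k$ have law $\mu$, and all the $\xi_k$ and $\tau_k$ are mutually independent. (5) $F(x)\le C_F$ for all $x\in\mathrm{dom}(r)$. Let $K\ge1$, $\bar\rho\in(\rho,2\rho]$, $\alpha>0$ and $\beta\ge0$ with $\frac{\alpha}{\sqrt K}\le\frac1{\bar\rho}$ and $\frac{\beta}{K^{1/4}}<1-\frac{\alpha\rho}{2\sqrt K}$, and set $\alpha_k=\frac{\alpha}{\sqrt K}$, $\beta_k=\frac{\beta}{K^{1/4}}$ for $k=1,\dots,K$. Let $x^{(1)}=x^{(0)}\in\mathrm{dom}(r)$ be deterministic and, for $k=1,\dots,K$, $$x^{(k+1)}=\mathrm{prox}_{\alpha_k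 r}\big(x^{(k)}-\alpha_k g^{(k)}+\beta_k(x^{(k)}-x^{(k-1)})\big),\qquad g^{(k)}=\tilde\nabla_k f(x^{(k-\tau_k)};\xi_k),$$ where $x^{(j)}:=x^{(1)}$ for $j\le0$. Let $T$ be drawn from $\{1,\dots,K\}$, independently of the samples and delays, with $\mathrm{Prob}(T=k)=\alpha_k/\sum_{j=1}^K\alpha_j$. Put $$\gamma=\tfrac12\Big(1-\tfrac{\alpha\rho}{2\sqrt K}-\tfrac{\beta}{K^{1/4}}\Big),\qquad B=\frac{\alpha}{\gamma\sqrt K}\big(\phi(x^{(1)})-\phi^*\big)+\frac{\alpha^2M^2}{\gamma^2}.$$ Then $\phi_{1/\bar\rho}$ is differentiable on $\mathbb R^n$, $\|\nabla\phi_{1/\bar\rho}(x^{(T)})\|^2$ is integrable, and $$\begin{aligned}\mathbb E\big\|\nabla\phi_{1/\bar\rho}(x^{(T)})\big\|^2\le\frac{2\bar\rho}{(\bar\rho-\rho)\alpha\sqrt K}\bigg[&\frac{\bar\rho}2\Big(2+\frac{2\sqrt K}{\alpha(\bar\rho-\rho)}\Big)\frac{\beta^2}{\sqrt K}B+4\bar\rho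 M^2\alpha^2\\&+\frac{\alpha\bar\rho\tau}{\sqrt K}\Big(\max\{0,-F(x^{(1)})\}+C_F+\tau\Big(\frac\rho2+\frac{\rho^2}{\bar\rho-\rho}\Big)B\Big)\\&+\phi_{1/\bar\rho}(x^{(1)})-\phi^*+M\alpha\bar\rho\tau\sqrt{B}\bigg].\end{aligned}$$ With all other quantities fixed, the right-hand side is $O(1/\sqrt K)$ as $K\to\infty$. -/

import Mathlib

open MeasureTheory ProbabilityTheory Filter Topology Asymptotics

noncomputable section

namespace InertialSubgradient

/-- `n`-dimensional real space with the Euclidean norm. -/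
abbrev Vec (n : ℕ) : Type := EuclideanSpace ℝ (Fin n)

/-- The subdifferential of `h` at `x`: all `v` such that
`h y ≥ h x + ⟪v, y - x⟫ + o(‖y - x‖)` as `y → x`. -/
def subdiff {n : ℕ} (h : Vec n → ℝ) (x : Vec n) : Set (Vec n) :=
  {v | ∀ ε : ℝ, 0 < ε → ∀ᶠ y in 𝓝 x, h x + inner ℝ v (y - x) - ε * ‖y - x‖ ≤ h y}

/-- `h` is `ρ`-weakly convex: `ρ > 0` and `h + (ρ/2)‖·‖²` is convex. -/
def WeaklyConvex {n : ℕ} (ρ : ℝ) (h : Vec n → ℝ) : Prop :=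
  0 < ρ ∧ ConvexOn ℝ Set.univ (fun x => h x + ρ / 2 * ‖x‖ ^ 2)

/-- The effective domain of an extended-real-valued function. -/
def effDom {n : ℕ} (r : Vec n → EReal) : Set (Vec n) := {x | r x < ⊤}

/-- `r : ℝⁿ → ℝ ∪ {+∞}` is convex and closed: it never takes the value `-∞`, its epigraph is
convex, and it is lower semicontinuous. -/
structure ClosedConvex {n : ℕ} (r : Vec n → EReal) : Prop where
  ne_bot : ∀ x, r x ≠ ⊥
  convex_epigraph : Convex ℝ {q : Vec n × ℝ | r q.1 ≤ (q.2 : EReal)}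
  lsc : LowerSemicontinuous r

/-- `y = prox_{c r}(z)`: `y` minimizes `r + (1/(2c)) ‖· - z‖²` over `ℝⁿ`. -/
def IsProx {n : ℕ} (c : ℝ) (r : Vec n → EReal) (z y : Vec n) : Prop :=
  ∀ w : Vec n,
    r y + ((1 / (2 * c) * ‖y - z‖ ^ 2 : ℝ) : EReal) ≤
      r w + ((1 / (2 * c) * ‖w - z‖ ^ 2 : ℝ) : EReal)

/-- `F(x) = E_ξ[f(x; ξ)]`, where `ξ` has law `μ`. -/
def expectedLoss {n : ℕ} {Ξ : Type*} [MeasurableSpace Ξ] (f : Vec n → Ξ → ℝ) (μ : Measure Ξ) :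
    Vec n → ℝ :=
  fun x => ∫ ξ, f x ξ ∂μ

/-- The composite objective `φ = F + r`. -/
def objective {n : ℕ} (F : Vec n → ℝ) (r : Vec n → EReal) : Vec n → EReal :=
  fun x => (F x : EReal) + r x

/-- The optimal value `φ* = inf φ`. -/
def optValue {n : ℕ} (φ : Vec n → EReal) : EReal := ⨅ x, φ x

/-- The Moreau envelope `φ_l(x) = inf_y { φ(y) + (1/(2l)) ‖y - x‖² }`. It is finite whenever `φ`
is bounded below and finite at some point, so nothing is lost by `toReal` there. -/
def moreauEnvelope {n : ℕ} (l : ℝ) (φ : Vec n → EReal) : Vec n → ℝ :=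
  fun x => (⨅ y, φ y + ((1 / (2 * l) * ‖y - x‖ ^ 2 : ℝ) : EReal)).toReal

/-- `g x ξ` is a measurable choice of a sample subgradient of `f(·; ξ)` at every `x ∈ dom r`. -/
structure IsSubgradientOracle {n : ℕ} {Ξ : Type*} [MeasurableSpace Ξ] (f : Vec n → Ξ → ℝ)
    (r : Vec n → EReal) (μ : Measure Ξ) (g : Vec n → Ξ → Vec n) : Prop where
  measurable : Measurable (Function.uncurry g)
  mem_subdiff : ∀ x ∈ effDom r, ∀ᵐ ξ ∂μ, g x ξ ∈ subdiff (fun y => f y ξ) x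

/-- The sample subgradients given by `g` are unbiased: `E_ξ[g(x; ξ)] ∈ ∂F(x)` on `dom r`. -/
def Unbiased {n : ℕ} {Ξ : Type*} [MeasurableSpace Ξ] (f : Vec n → Ξ → ℝ)
    (r : Vec n → EReal) (μ : Measure Ξ) (g : Vec n → Ξ → Vec n) : Prop :=
  ∀ x ∈ effDom r, ∫ ξ, g x ξ ∂μ ∈ subdiff (expectedLoss f μ) x

/-- For every `x ∈ dom r` and every measurable choice `s(ξ) ∈ ∂f(x; ξ)`, `E_ξ‖s(ξ)‖² ≤ M²`. -/
def BoundedSubgradients {n : ℕ} {Ξ : Type*} [MeasurableSpace Ξ] (f : Vec n → Ξ → ℝ)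
    (r : Vec n → EReal) (μ : Measure Ξ) (M : ℝ) : Prop :=
  ∀ x ∈ effDom r, ∀ s : Ξ → Vec n, Measurable s →
    (∀ᵐ ξ ∂μ, s ξ ∈ subdiff (fun y => f y ξ) x) →
    ∫⁻ ξ, ‖s ξ‖ₑ ^ 2 ∂μ ≤ ENNReal.ofReal (M ^ 2)

/-- `x⁽⁰⁾, x⁽¹⁾, …, x⁽ᴷ⁺¹⁾` are the iterates of `K` steps of the distributed stochastic inertial
subgradient method started at `x₀ ∈ dom r`, with stepsizes `a k`, inertial parameters `b k`,
samples `ξ k`, delays `d k`, and the rule `g k` that picks the sample subgradient in step `k`.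
Subtraction in `k - d k ω` is truncated, so a negative index is read as the starting point. -/
structure IsIterateSequence {n : ℕ} {Ξ Ω : Type*} (r : Vec n → EReal)
    (g : ℕ → Vec n → Ξ → Vec n) (a b : ℕ → ℝ) (ξ : ℕ → Ω → Ξ) (d : ℕ → Ω → ℕ)
    (K : ℕ) (x₀ : Vec n) (x : ℕ → Ω → Vec n) : Prop where
  start_mem : x₀ ∈ effDom r
  zero : ∀ ω, x 0 ω = x₀
  one : ∀ ω, x 1 ω = x₀
  step : ∀ k ∈ Set.Icc 1 K, ∀ ω,
    IsProx (a k) r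
      (x k ω - a k • g k (x (k - d k ω) ω) (ξ k ω) + b k • (x k ω - x (k - 1) ω))
      (x (k + 1) ω)

/-- The randomness in `K` steps: the samples `ξ k` have law `μ`, the delays `d k` take the value
`j ∈ {0, …, τ}` with probability `p j`, and the family of all `ξ k` and all `d k`,
`1 ≤ k ≤ K`, is mutually independent (the pairs are mutually independent, and so are the two
entries of each pair). -/
structure IsSampling {Ξ Ω : Type*} [MeasurableSpace Ξ] [MeasurableSpace Ω] (P : Measure Ω)
    (μ : Measure Ξ) (τ : ℕ) (p : ℕ → ℝ) (K : ℕ) (ξ : ℕ → Ω → Ξ) (d : ℕ → Ω → ℕ) : Prop where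
  measurable_sample : ∀ k ∈ Set.Icc 1 K, Measurable (ξ k)
  measurable_delay : ∀ k ∈ Set.Icc 1 K, Measurable (d k)
  law_sample : ∀ k ∈ Set.Icc 1 K, P.map (ξ k) = μ
  law_delay : ∀ k ∈ Set.Icc 1 K, ∀ j ≤ τ, P.real {ω | d k ω = j} = p j
  sum_law_delay : ∑ j ∈ Finset.range (τ + 1), p j = 1
  indep_steps : iIndepFun (fun (k : Set.Icc 1 K) ω => (ξ k ω, d k ω)) P
  indep_sample_delay : ∀ k ∈ Set.Icc 1 K, IndepFun (ξ k) (d k) P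

/-- `T` is drawn from `{1, …, K}`, independently of the samples and delays, with probability
proportional to the stepsizes `a k`. -/
structure IsRandomIndex {Ξ Ω : Type*} [MeasurableSpace Ξ] [MeasurableSpace Ω] (P : Measure Ω)
    (a : ℕ → ℝ) (K : ℕ) (ξ : ℕ → Ω → Ξ) (d : ℕ → Ω → ℕ) (T : Ω → ℕ) : Prop where
  measurable : Measurable T
  law : ∀ k ∈ Set.Icc 1 K, P.real {ω | T ω = k} = a k / ∑ j ∈ Finset.Icc 1 K, a j
  indep : IndepFun T (fun ω (k : Set.Icc 1 K) => (ξ k ω, d k ω)) P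

/-- `γ = (1/2) (1 - αρ/(2√K) - β/K^{1/4})`. -/
def gam (ρ α β : ℝ) (K : ℕ) : ℝ :=
  1 / 2 * (1 - α * ρ / (2 * √(K : ℝ)) - β / (K : ℝ) ^ (1 / 4 : ℝ))

/-- `α/(γ√K) (φ(x⁽¹⁾) - φ*) + α²M²/γ²`, with `φ₁` for `φ(x⁽¹⁾)` and `φs` for `φ*`. -/
def moveBound (ρ α β M φ₁ φs : ℝ) (K : ℕ) : ℝ :=
  α / (gam ρ α β K * √(K : ℝ)) * (φ₁ - φs) + α ^ 2 * M ^ 2 / gam ρ α β K ^ 2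

/-- The right-hand side of the rate, with `F₁` for `F(x⁽¹⁾)`, `φ₁` for `φ(x⁽¹⁾)`, `e₁` for the
Moreau envelope at `x⁽¹⁾`, and `φs` for `φ*`. -/
def rateBound (ρ ρ' α β M CF : ℝ) (τ : ℕ) (F₁ φ₁ e₁ φs : ℝ) (K : ℕ) : ℝ :=
  2 * ρ' / ((ρ' - ρ) * α * √(K : ℝ)) *
    (ρ' / 2 * (2 + 2 * √(K : ℝ) / (α * (ρ' - ρ))) * (β ^ 2 / √(K : ℝ)) *
        moveBound ρ α β M φ₁ φs K
      + 4 * ρ' * M ^ 2 * α ^ 2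
      + α * ρ' * τ / √(K : ℝ) *
        (max 0 (-F₁) + CF
          + τ * (ρ / 2 + ρ ^ 2 / (ρ' - ρ)) * moveBound ρ α β M φ₁ φs K)
      + (e₁ - φs)
      + M * α * ρ' * τ * √(moveBound ρ α β M φ₁ φs K))

end InertialSubgradient

end
open InertialSubgradient

/-! Write a = α/√K, b = β/K^{1/4}, φ = F + r, and let q be the proximal point of φ at x with
parameter 1/ρ'. Since φ is ρ-weakly convex and ρ < ρ', q is unique and Lipschitz in x, and
∇φ_{1/ρ'}(x) = ρ'(x - q) (`hasGradientAt_moreauEnvelope`). It therefore suffices to bound the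
average of E‖x_k - q_k‖² over k. Two Lyapunov functions do this.

The first is a φ(x_k) + (b/2)‖x_k - x_{k-1}‖² (`potential_step_le`). It loses γ‖x_{k+1} - x_k‖² per
step, up to a noise term of order a²M². Since K a² = α², telescoping bounds the sum of all E‖x_k -
x_{k-1}‖² by B (`sum_increment_le`).

The second is the Moreau envelope along the iterates (`moreauEnvelope_step_le`). The point q_k is a
competitor in the envelope at x_{k+1}, and comparing the optimality conditions of x_{k+1} and q_k
shows that ‖x_{k+1} - q_k‖² is at most (1 - a(ρ' - ρ))‖x_k - q_k‖² plus errors. The errors are of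
four kinds. Inertia contributes multiples of ‖x_k - x_{k-1}‖², summable by the first part. The
second moments contribute a²M² per step. The centred noise has mean zero against x_k - q_k, because
the new sample is independent of the past together with the delay (`integral_noise`). The delay
contributes powers of ‖x_k - x_{k-τ_k}‖, controlled by B, and F(x_k) - F(x_{k-τ_k}), whose
expectations telescope because all delays have the same law (`sum_loss_sub_delayed_le`).

Summing (`sum_sq_residual_le`), dividing by the coefficient of the residuals and averaging over the
uniform index T gives the rate. The remaining work is to show that the iterates are measurable in
the past and square integrable. -/

noncomputable section

namespace InertialSubgradient

/-! ### Weak convexity, subgradients and proximal points. -/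

section

/-- Weak convexity of an extended-real-valued function, as an inequality along segments of its
effective domain. -/
def SegmentWeaklyConvex {n : ℕ} (ρ : ℝ) (h : Vec n → EReal) : Prop :=
  ∀ x ∈ effDom h, ∀ y ∈ effDom h, ∀ t ∈ Set.Ioo (0 : ℝ) 1,
    x + t • (y - x) ∈ effDom h ∧
      (h (x + t • (y - x))).toReal ≤
        (1 - t) * (h x).toReal + t * (h y).toReal + ρ / 2 * (t * (1 - t)) * ‖y - x‖ ^ 2

section Norms

variable {V : Type*} [NormedAddCommGroup V] [InnerProductSpace ℝ V]

theorem norm_add_smul_sq (u w : V) (t : ℝ) :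
    ‖u + t • w‖ ^ 2 = ‖u‖ ^ 2 + 2 * t * inner ℝ u w + t ^ 2 * ‖w‖ ^ 2 := by
  rw [norm_add_sq_real, inner_smul_right, norm_smul, mul_pow, Real.norm_eq_abs, sq_abs]
  ring

theorem norm_segment_sq (x y : V) (t : ℝ) :
    ‖x + t • (y - x)‖ ^ 2 = (1 - t) * ‖x‖ ^ 2 + t * ‖y‖ ^ 2 - t * (1 - t) * ‖y - x‖ ^ 2 := by
  rw [norm_add_smul_sq, norm_sub_sq_real, inner_sub_right, real_inner_self_eq_norm_sq,
    real_inner_comm y x]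
  ring

end Norms

variable {n : ℕ}

theorem WeaklyConvex.segment_le {ρ : ℝ} {F : Vec n → ℝ} (hF : WeaklyConvex ρ F) (x y : Vec n)
    {t : ℝ} (ht : t ∈ Set.Ioo (0 : ℝ) 1) :
    F (x + t • (y - x)) ≤
      (1 - t) * F x + t * F y + ρ / 2 * (t * (1 - t)) * ‖y - x‖ ^ 2 := by
  have h := hF.2.2 (Set.mem_univ x) (Set.mem_univ y) (sub_nonneg.2 ht.2.le) ht.1.le
    (sub_add_cancel 1 t)
  have e : (1 - t) • x + t • y = x + t • (y - x) := by module
  simp only [e, smul_eq_mul, norm_segment_sq] at h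
  linarith

theorem WeaklyConvex.continuous {ρ : ℝ} {F : Vec n → ℝ} (hF : WeaklyConvex ρ F) :
    Continuous F := by
  have h := hF.2.locallyLipschitz.continuous
  have e : F = fun x => (F x + ρ / 2 * ‖x‖ ^ 2) - ρ / 2 * ‖x‖ ^ 2 := by
    funext x; ring
  rw [e]
  exact h.sub (by fun_prop)

/-- The local inequality at x + t(y - x), combined with weak convexity along the segment and divided
by t, becomes global. The number ε is scaled so that the little-o error costs at most δ at y. -/
theorem WeaklyConvex.le_of_mem_subdiff {ρ : ℝ} {F : Vec n → ℝ} (hF : WeaklyConvex ρ F)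
    {x v : Vec n} (hv : v ∈ subdiff F x) (y : Vec n) :
    F x + inner ℝ v (y - x) - ρ / 2 * ‖y - x‖ ^ 2 ≤ F y := by
  refine le_of_forall_pos_le_add fun δ hδ => ?_
  set ε := δ / (‖y - x‖ + 1) with hε
  have hd : 0 < ‖y - x‖ + 1 := by positivity
  have hεpos : 0 < ε := by positivity
  have hεle : ε * ‖y - x‖ ≤ δ := by
    rw [hε, div_mul_eq_mul_div, div_le_iff₀ hd]
    nlinarith [norm_nonneg (y - x)]
  have hlim : Tendsto (fun t : ℝ => x + t • (y - x)) (𝓝[>] 0) (𝓝 x) := by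
    have : Tendsto (fun t : ℝ => x + t • (y - x)) (𝓝 0) (𝓝 (x + (0 : ℝ) • (y - x))) :=
      Continuous.tendsto (by fun_prop) _
    rw [zero_smul, add_zero] at this
    exact this.mono_left nhdsWithin_le_nhds
  obtain ⟨t, ht, ht01⟩ := ((hlim.eventually (hv ε hεpos)).and
    (Ioo_mem_nhdsGT (zero_lt_one' ℝ))).exists
  have h1 := hF.segment_le x y ht01
  rw [add_sub_cancel_left, inner_smul_right, norm_smul, Real.norm_eq_abs,
    abs_of_pos ht01.1] at ht
  have h2 : t * (F x + inner ℝ v (y - x) - ε * ‖y - x‖) ≤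
      t * (F y + ρ / 2 * (1 - t) * ‖y - x‖ ^ 2) := by linarith
  have h3 := le_of_mul_le_mul_left h2 ht01.1
  have h4 : 0 ≤ ρ / 2 * t * ‖y - x‖ ^ 2 := by
    have := hF.1
    have := ht01.1
    positivity
  linarith

section Prox

variable {h : Vec n → EReal} {c ρ : ℝ}

theorem IsProx.mem_effDom {z y x₀ : Vec n} (hp : IsProx c h z y) (hx₀ : x₀ ∈ effDom h) :
    y ∈ effDom h := by
  have h1 := (hp x₀).trans_lt (EReal.add_lt_top (ne_of_lt hx₀) (EReal.coe_ne_top _))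
  by_contra hy
  have hy' : h y = ⊤ := by simpa [effDom] using hy
  rw [hy', EReal.top_add_coe] at h1
  exact lt_irrefl _ h1

theorem coe_toReal_of_mem_effDom (hbot : ∀ x, h x ≠ ⊥) {x : Vec n} (hx : x ∈ effDom h) :
    ((h x).toReal : EReal) = h x :=
  EReal.coe_toReal (ne_of_lt hx) (hbot x)

theorem IsProx.toReal_le (hbot : ∀ x, h x ≠ ⊥) {z y w : Vec n} (hp : IsProx c h z y)
    (hw : w ∈ effDom h) :
    (h y).toReal + 1 / (2 * c) * ‖y - z‖ ^ 2 ≤ (h w).toReal + 1 / (2 * c) * ‖w - z‖ ^ 2 := by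
  have h1 := hp w
  rw [← coe_toReal_of_mem_effDom hbot hw,
    ← coe_toReal_of_mem_effDom hbot (hp.mem_effDom hw)] at h1
  exact_mod_cast h1

/-- If `0 ≤ A + B t` for all small `t > 0`, then `0 ≤ A`. -/
theorem nonneg_of_forall_add_mul_nonneg {A B : ℝ}
    (hAB : ∀ t ∈ Set.Ioo (0 : ℝ) 1, 0 ≤ A + B * t) : 0 ≤ A := by
  have hlim : Tendsto (fun t : ℝ => A + B * t) (𝓝[>] 0) (𝓝 A) := by
    have : Tendsto (fun t : ℝ => A + B * t) (𝓝 0) (𝓝 (A + B * 0)) :=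
      Continuous.tendsto (by fun_prop) _
    rw [mul_zero, add_zero] at this
    exact this.mono_left nhdsWithin_le_nhds
  refine ge_of_tendsto hlim ?_
  filter_upwards [Ioo_mem_nhdsGT (zero_lt_one' ℝ)] with t ht using hAB t ht

/-- First-order optimality of a proximal point of a weakly convex function. -/
theorem IsProx.variational (hbot : ∀ x, h x ≠ ⊥) (hconv : SegmentWeaklyConvex ρ h)
    {z y w : Vec n} (hp : IsProx c h z y) (hw : w ∈ effDom h) :
    (h y).toReal + 1 / c * inner ℝ (z - y) (w - y) - ρ / 2 * ‖w - y‖ ^ 2 ≤ (h w).toReal := by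
  have hy := hp.mem_effDom hw
  suffices H : 0 ≤ (h w).toReal - ((h y).toReal + 1 / c * inner ℝ (z - y) (w - y)
      - ρ / 2 * ‖w - y‖ ^ 2) by linarith
  -- Minimality of y against y + t(w - y), divided by t; the terms of second order in t form `B *
  -- t`.
  refine nonneg_of_forall_add_mul_nonneg
    (B := (1 / (2 * c) - ρ / 2) * ‖w - y‖ ^ 2) fun t ht => ?_
  obtain ⟨hmem, hle⟩ := hconv y hy w hw t ht
  have h1 := hp.toReal_le hbot hmem
  have e : y + t • (w - y) - z = (y - z) + t • (w - y) := by abel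
  rw [e, norm_add_smul_sq] at h1
  have e2 : inner ℝ (y - z) (w - y) = -inner ℝ (z - y) (w - y) := by
    rw [← inner_neg_left, neg_sub]
  rw [e2] at h1
  have hc : 1 / (2 * c) = 1 / 2 * (1 / c) := by
    rw [one_div, one_div, one_div, mul_inv]
  rw [hc] at h1 ⊢
  have h2 : 0 ≤ t * ((h w).toReal - ((h y).toReal + 1 / c * inner ℝ (z - y) (w - y)
      - ρ / 2 * ‖w - y‖ ^ 2) + (1 / 2 * (1 / c) - ρ / 2) * ‖w - y‖ ^ 2 * t) := by
    nlinarith [h1, hle]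
  exact nonneg_of_mul_nonneg_right h2 ht.1

/-- Each variational inequality is tested at the other proximal point. In the sum the values of `h`
cancel and monotonicity with modulus 1/c - ρ remains. -/
theorem IsProx.norm_sub_le (hbot : ∀ x, h x ≠ ⊥) (hconv : SegmentWeaklyConvex ρ h)
    (hne : (effDom h).Nonempty) (hc : 0 < c) {z z' y y' : Vec n} (hp : IsProx c h z y)
    (hp' : IsProx c h z' y') :
    (1 / c - ρ) * ‖y - y'‖ ^ 2 ≤ 1 / c * (‖z - z'‖ * ‖y - y'‖) := by
  obtain ⟨x₀, hx₀⟩ := hne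
  have h1 := hp.variational hbot hconv (hp'.mem_effDom hx₀)
  have h2 := hp'.variational hbot hconv (hp.mem_effDom hx₀)
  have h3 := real_inner_le_norm (z - z') (y - y')
  have e1 : inner ℝ (z - y) (y' - y) + inner ℝ (z' - y') (y - y') =
      ‖y - y'‖ ^ 2 - inner ℝ (z - z') (y - y') := by
    rw [← real_inner_self_eq_norm_sq, ← neg_sub y y', inner_neg_right, ← sub_eq_neg_add,
      ← inner_sub_left, ← inner_sub_left]
    congr 1
    abel
  rw [norm_sub_rev y' y] at h1
  have h4 : 1 / c * (inner ℝ (z - y) (y' - y) + inner ℝ (z' - y') (y - y')) ≤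
      ρ * ‖y - y'‖ ^ 2 := by linarith
  rw [e1] at h4
  have h5 := mul_le_mul_of_nonneg_left h3 (one_div_pos.2 hc).le
  linarith

theorem IsProx.dist_le (hbot : ∀ x, h x ≠ ⊥) (hconv : SegmentWeaklyConvex ρ h)
    (hne : (effDom h).Nonempty) (hc : 0 < c) (hcρ : ρ < 1 / c) {z z' y y' : Vec n}
    (hp : IsProx c h z y) (hp' : IsProx c h z' y') :
    ‖y - y'‖ ≤ 1 / c / (1 / c - ρ) * ‖z - z'‖ := by
  have h1 := hp.norm_sub_le hbot hconv hne hc hp'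
  have hpos : 0 < 1 / c - ρ := by linarith
  rcases (norm_nonneg (y - y')).eq_or_lt with h0 | h0
  · rw [← h0]; positivity
  rw [div_mul_eq_mul_div, le_div_iff₀ hpos]
  refine le_of_mul_le_mul_right ?_ h0
  linarith

theorem exists_isProx (hlsc : LowerSemicontinuous h) {m : ℝ} (hm : ∀ x, (m : EReal) ≤ h x)
    (hne : (effDom h).Nonempty) (hc : 0 < c) (z : Vec n) : ∃ y, IsProx c h z y := by
  obtain ⟨x₀, hx₀⟩ := hne
  have hbot : ∀ x, h x ≠ ⊥ := fun x => ne_of_gt ((EReal.bot_lt_coe m).trans_le (hm x))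
  set q : Vec n → EReal := fun y => h y + ((1 / (2 * c) * ‖y - z‖ ^ 2 : ℝ) : EReal) with hq
  have hqlsc : LowerSemicontinuous q := by
    refine hlsc.add' (Continuous.lowerSemicontinuous ?_) fun x => ?_
    · exact continuous_coe_real_ereal.comp (by fun_prop)
    · exact EReal.continuousAt_add (Or.inr (EReal.coe_ne_bot _)) (Or.inr (EReal.coe_ne_top _))
  set A : ℝ := (h x₀).toReal + 1 / (2 * c) * ‖x₀ - z‖ ^ 2 - m with hA
  have hqx₀ : q x₀ = ((A + m : ℝ) : EReal) := by
    rw [hq]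
    simp only
    rw [← coe_toReal_of_mem_effDom hbot hx₀, hA]
    norm_cast
    ring
  -- With R ≥ 1 and R ≥ 2c|A|, a point outside the ball has quadratic term at least A, so its value
  -- is at least A + m = `q x₀`; a minimizer over the compact ball is then global.
  set R : ℝ := ‖x₀ - z‖ + 2 * c * |A| + 1 with hR
  have hR1 : 1 ≤ R := by
    have : 0 ≤ 2 * c * |A| := by positivity
    linarith [norm_nonneg (x₀ - z)]
  have hxmem : x₀ ∈ Metric.closedBall z R := by
    have : 0 ≤ 2 * c * |A| := by positivity
    rw [mem_closedBall_iff_norm]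
    linarith
  obtain ⟨y, -, hy⟩ := hqlsc.lowerSemicontinuousOn (Metric.closedBall z R)
    |>.exists_isMinOn ⟨x₀, hxmem⟩ (isCompact_closedBall z R)
  refine ⟨y, fun w => ?_⟩
  by_cases hw : w ∈ Metric.closedBall z R
  · exact hy hw
  · refine (hy hxmem).trans ?_
    change q x₀ ≤ q w
    have hwR : R < ‖w - z‖ := by
      rwa [mem_closedBall_iff_norm, not_le] at hw
    have h1 : A ≤ 1 / (2 * c) * ‖w - z‖ ^ 2 := by
      rw [div_mul_eq_mul_div, le_div_iff₀ (by positivity)]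
      have h2 : 2 * c * |A| ≤ R := by linarith [norm_nonneg (x₀ - z)]
      have h3 : A * (2 * c) ≤ 2 * c * |A| := by nlinarith [le_abs_self A]
      nlinarith
    rw [hqx₀, add_comm A m, EReal.coe_add]
    exact add_le_add (hm w) (EReal.coe_le_coe_iff.2 h1)

end Prox

end

/-! ### The composite objective and its Moreau envelope. -/

section

variable {n : ℕ}

theorem ClosedConvex.segmentWeaklyConvex {r : Vec n → EReal} (hr : ClosedConvex r) :
    SegmentWeaklyConvex 0 r := by
  intro x hx y hy t ht
  have hx' : (x, (r x).toReal) ∈ {q : Vec n × ℝ | r q.1 ≤ (q.2 : EReal)} :=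
    (coe_toReal_of_mem_effDom hr.ne_bot hx).ge
  have hy' : (y, (r y).toReal) ∈ {q : Vec n × ℝ | r q.1 ≤ (q.2 : EReal)} :=
    (coe_toReal_of_mem_effDom hr.ne_bot hy).ge
  have h := hr.convex_epigraph hx' hy' (sub_nonneg.2 ht.2.le) ht.1.le (sub_add_cancel 1 t)
  have e : (1 - t) • x + t • y = x + t • (y - x) := by module
  simp only [Set.mem_ofPred_eq, Prod.fst_add, Prod.smul_fst, Prod.snd_add, Prod.smul_snd, e,
    smul_eq_mul] at h
  have hmem : x + t • (y - x) ∈ effDom r := h.trans_lt (EReal.coe_lt_top _)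
  refine ⟨hmem, ?_⟩
  rw [← coe_toReal_of_mem_effDom hr.ne_bot hmem, EReal.coe_le_coe_iff] at h
  linarith

section Objective

variable {F : Vec n → ℝ} {r : Vec n → EReal} {ρ : ℝ}

theorem effDom_objective (F : Vec n → ℝ) (r : Vec n → EReal) :
    effDom (objective F r) = effDom r := by
  ext x
  simp only [effDom, objective, Set.mem_ofPred_eq, lt_top_iff_ne_top]
  exact EReal.add_ne_top_iff_ne_top_right (EReal.coe_ne_bot _) (EReal.coe_ne_top _)

theorem objective_ne_bot (F : Vec n → ℝ) (hr : ∀ x, r x ≠ ⊥) (x : Vec n) :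
    objective F r x ≠ ⊥ :=
  EReal.add_ne_bot_iff.2 ⟨EReal.coe_ne_bot _, hr x⟩

theorem toReal_objective (F : Vec n → ℝ) (hr : ∀ x, r x ≠ ⊥) {x : Vec n} (hx : x ∈ effDom r) :
    (objective F r x).toReal = F x + (r x).toReal := by
  rw [objective, EReal.toReal_add (EReal.coe_ne_top _) (EReal.coe_ne_bot _) (ne_of_lt hx) (hr x),
    EReal.toReal_coe]

theorem segmentWeaklyConvex_objective (hF : WeaklyConvex ρ F) (hr : ClosedConvex r) :
    SegmentWeaklyConvex ρ (objective F r) := by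
  intro x hx y hy t ht
  rw [effDom_objective F r] at hx hy ⊢
  obtain ⟨hmem, hle⟩ := hr.segmentWeaklyConvex x hx y hy t ht
  refine ⟨hmem, ?_⟩
  rw [toReal_objective F hr.ne_bot hx, toReal_objective F hr.ne_bot hy,
    toReal_objective F hr.ne_bot hmem]
  have := hF.segment_le x y ht
  linarith

theorem lowerSemicontinuous_objective (hF : Continuous F) (hr : LowerSemicontinuous r) :
    LowerSemicontinuous (objective F r) := by
  refine LowerSemicontinuous.add' (Continuous.lowerSemicontinuous ?_) hr fun x => ?_
  · exact continuous_coe_real_ereal.comp hF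
  · exact EReal.continuousAt_add (Or.inl (EReal.coe_ne_top _)) (Or.inl (EReal.coe_ne_bot _))

end Objective

theorem coe_toReal_optValue {φ : Vec n → EReal} (hbdd : optValue φ ≠ ⊥)
    (hne : (effDom φ).Nonempty) : ((optValue φ).toReal : EReal) = optValue φ := by
  obtain ⟨x₀, hx₀⟩ := hne
  exact EReal.coe_toReal (ne_of_lt ((iInf_le φ x₀).trans_lt hx₀)) hbdd

theorem toReal_optValue_le {φ : Vec n → EReal} (hbdd : optValue φ ≠ ⊥) {x : Vec n}
    (hx : x ∈ effDom φ) : (optValue φ).toReal ≤ (φ x).toReal :=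
  EReal.toReal_le_toReal (iInf_le φ x) hbdd (ne_of_lt hx)

section Moreau

variable {φ : Vec n → EReal} {l ρ : ℝ}

theorem IsProx.moreauEnvelope_eq (hbot : ∀ x, φ x ≠ ⊥) (hne : (effDom φ).Nonempty)
    {x y : Vec n} (hp : IsProx l φ x y) :
    moreauEnvelope l φ x = (φ y).toReal + 1 / (2 * l) * ‖y - x‖ ^ 2 := by
  obtain ⟨x₀, hx₀⟩ := hne
  have h : (⨅ w, φ w + ((1 / (2 * l) * ‖w - x‖ ^ 2 : ℝ) : EReal)) =
      φ y + ((1 / (2 * l) * ‖y - x‖ ^ 2 : ℝ) : EReal) :=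
    le_antisymm (iInf_le _ y) (le_iInf hp)
  rw [moreauEnvelope, h, ← coe_toReal_of_mem_effDom hbot (hp.mem_effDom hx₀), ← EReal.coe_add,
    EReal.toReal_coe, EReal.toReal_coe]

theorem IsProx.moreauEnvelope_le (hbot : ∀ x, φ x ≠ ⊥) {x y w : Vec n} (hp : IsProx l φ x y)
    (hw : w ∈ effDom φ) :
    moreauEnvelope l φ x ≤ (φ w).toReal + 1 / (2 * l) * ‖w - x‖ ^ 2 := by
  rw [hp.moreauEnvelope_eq hbot ⟨w, hw⟩]
  exact hp.toReal_le hbot hw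

/-- Testing the envelope at one point with the proximal point of another gives a quadratic upper
bound for its increment. Used in both directions, with the Lipschitz bound for `pr` comparing the
two slopes, it leaves a first-order error O(‖y - x‖²). -/
theorem hasGradientAt_moreauEnvelope (hbot : ∀ x, φ x ≠ ⊥) (hconv : SegmentWeaklyConvex ρ φ)
    (hne : (effDom φ).Nonempty) (hl : 0 < l) (hlρ : ρ < 1 / l) {pr : Vec n → Vec n}
    (hpr : ∀ x, IsProx l φ x (pr x)) (x : Vec n) :
    HasGradientAt (moreauEnvelope l φ) ((1 / l) • (x - pr x)) x := by
  obtain ⟨x₀, hx₀⟩ := id hne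
  set L : ℝ := 1 / l / (1 / l - ρ) with hL
  have hlip : ∀ y, ‖pr y - pr x‖ ≤ L * ‖y - x‖ := fun y =>
    (hpr y).dist_le hbot hconv hne hl hlρ (hpr x)
  have hlinv : 0 < 1 / l := one_div_pos.2 hl
  have hhalf : 1 / (2 * l) = 1 / 2 * (1 / l) := by rw [one_div, one_div, one_div, mul_inv]
  have hL0 : 0 ≤ L := by
    have : 0 < 1 / l - ρ := by linarith
    positivity
  have hup : ∀ y z, moreauEnvelope l φ z - moreauEnvelope l φ y ≤
      1 / l * inner ℝ (y - pr y) (z - y) + 1 / 2 * (1 / l) * ‖z - y‖ ^ 2 := by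
    intro y z
    have h1 := (hpr z).moreauEnvelope_le hbot ((hpr y).mem_effDom hx₀)
    rw [(hpr y).moreauEnvelope_eq hbot hne]
    have e : ‖pr y - z‖ ^ 2 = ‖pr y - y‖ ^ 2 + 2 * inner ℝ (y - pr y) (z - y)
        + ‖z - y‖ ^ 2 := by
      have : pr y - z = (pr y - y) - (z - y) := by abel
      rw [this, norm_sub_sq_real, ← neg_sub y (pr y), inner_neg_left, norm_neg]
      ring
    rw [e, hhalf] at h1
    rw [hhalf]
    linarith
  rw [hasGradientAt_iff_isLittleO]
  have hO : (fun y => moreauEnvelope l φ y - moreauEnvelope l φ x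
      - inner ℝ ((1 / l) • (x - pr x)) (y - x)) =O[𝓝 x] fun y => ‖y - x‖ ^ 2 := by
    refine IsBigO.of_bound (1 / l * (2 + L)) (Eventually.of_forall fun y => ?_)
    rw [Real.norm_eq_abs, Real.norm_of_nonneg (by positivity), inner_smul_left]
    simp only [conj_trivial]
    have h1 := hup x y
    have h2 := hup y x
    have h3 : inner ℝ (y - pr y) (x - y) =
        -inner ℝ (x - pr x) (y - x) - ‖y - x‖ ^ 2 + inner ℝ (pr y - pr x) (y - x) := by
      rw [← real_inner_self_eq_norm_sq, ← neg_sub y x, inner_neg_right, ← inner_neg_left,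
        ← inner_neg_left, ← inner_sub_left, ← inner_add_left]
      congr 1
      abel
    have h4 : inner ℝ (pr y - pr x) (y - x) ≤ L * ‖y - x‖ ^ 2 := by
      refine (real_inner_le_norm _ _).trans ?_
      nlinarith [hlip y, norm_nonneg (y - x)]
    rw [h3, norm_sub_rev x y] at h2
    have h5 := mul_le_mul_of_nonneg_left h4 hlinv.le
    have h6 : 0 ≤ 1 / l * ‖y - x‖ ^ 2 := by positivity
    have h7 : 0 ≤ 1 / l * (L * ‖y - x‖ ^ 2) := by positivity
    rw [abs_le]
    constructor <;> linarith
  refine hO.trans_isLittleO ?_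
  have : (fun y => ‖y - x‖ ^ 2) =o[𝓝 x] fun y => ‖y - x‖ := by
    have h0 : Tendsto (fun y => ‖y - x‖) (𝓝 x) (𝓝 0) := by
      have : Tendsto (fun y => ‖y - x‖) (𝓝 x) (𝓝 ‖x - x‖) :=
        Continuous.tendsto (by fun_prop) _
      simpa using this
    have h1 := ((isLittleO_one_iff ℝ).2 h0).mul_isBigO (isBigO_refl (fun y => ‖y - x‖) (𝓝 x))
    simpa [sq] using h1
  exact this.of_norm_right

end Moreau

section LimitingSubgradient

/-- At a proximal point `q` of `φ = F + r` and for every `y ∈ dom r` there is a subgradient of `F`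
that is bounded by `M` and certifies optimality of `q` in the direction of `y`. -/
theorem exists_bounded_subgradient {F : Vec n → ℝ} {r : Vec n → EReal} {ρ M c : ℝ}
    (hF : WeaklyConvex ρ F) (hr : ClosedConvex r) {G : Vec n → Vec n}
    (hG : ∀ x ∈ effDom r, G x ∈ subdiff F x) (hGM : ∀ x ∈ effDom r, ‖G x‖ ≤ M)
    {x q y : Vec n} (hq : IsProx c (objective F r) x q) (hy : y ∈ effDom r) :
    ∃ v : Vec n, ‖v‖ ≤ M ∧ (∀ z, F q + inner ℝ v (z - q) - ρ / 2 * ‖z - q‖ ^ 2 ≤ F z) ∧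
      (r q).toReal + 1 / c * inner ℝ (x - q) (y - q) ≤ (r y).toReal + inner ℝ v (y - q) := by
  have hdom := effDom_objective F r
  have hqd : q ∈ effDom r := hdom ▸ hq.mem_effDom (hdom.symm ▸ hy)
  -- Only the selection `G` is known to be bounded by M. A subgradient at q is therefore obtained as
  -- a cluster point of `G` along the segment from y to q, which lies in dom r; it may depend on y.
  -- The shift by 2 keeps t in the open unit interval.
  set t : ℕ → ℝ := fun k => 1 / ((k : ℝ) + 2) with ht
  have ht01 : ∀ k, t k ∈ Set.Ioo (0 : ℝ) 1 := fun k => by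
    have hk : (0 : ℝ) ≤ k := Nat.cast_nonneg k
    refine ⟨by positivity, ?_⟩
    rw [ht]
    simp only
    rw [div_lt_one (by positivity)]
    linarith
  have htlim : Tendsto t atTop (𝓝 0) := by
    have h1 := (tendsto_add_atTop_iff_nat 2).2 (tendsto_const_div_atTop_nhds_zero_nat (1 : ℝ))
    simpa [ht] using h1
  set p : ℕ → Vec n := fun k => q + t k • (y - q) with hp
  have hseg := fun k => hr.segmentWeaklyConvex q hqd y hy (t k) (ht01 k)
  have hplim : Tendsto p atTop (𝓝 q) := by
    simpa using tendsto_const_nhds (x := q) |>.add (htlim.smul_const (y - q))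
  obtain ⟨v, hv, ψ, hψ, hlim⟩ := (isCompact_closedBall (0 : Vec n) M).tendsto_subseq
    (x := fun k => G (p k)) (fun k => by
      rw [mem_closedBall_zero_iff]
      exact hGM _ (hseg k).1)
  have hpψ := hplim.comp hψ.tendsto_atTop
  have htψ := htlim.comp hψ.tendsto_atTop
  have hFc := hF.continuous
  have hbot := objective_ne_bot F hr.ne_bot
  refine ⟨v, by simpa using hv, fun z => ?_, ?_⟩
  · have h1 : Tendsto (fun k => F (p (ψ k)) + inner ℝ (G (p (ψ k))) (z - p (ψ k))
        - ρ / 2 * ‖z - p (ψ k)‖ ^ 2) atTop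
        (𝓝 (F q + inner ℝ v (z - q) - ρ / 2 * ‖z - q‖ ^ 2)) := by
      have h2 := tendsto_const_nhds (x := z) |>.sub hpψ
      exact (((hFc.tendsto q).comp hpψ).add (hlim.inner h2)).sub ((h2.norm.pow 2).const_mul _)
    exact le_of_tendsto' h1 fun k => hF.le_of_mem_subdiff (hG _ (hseg _).1) z
  · have h1 : Tendsto (fun k => (r y).toReal + inner ℝ (G (p (ψ k))) (y - q)
        + (ρ / 2 + 1 / (2 * c)) * ‖y - q‖ ^ 2 * t (ψ k)) atTop
        (𝓝 ((r y).toReal + inner ℝ v (y - q)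
          + (ρ / 2 + 1 / (2 * c)) * ‖y - q‖ ^ 2 * 0)) :=
      ((hlim.inner tendsto_const_nhds).const_add _).add (htψ.const_mul _)
    rw [mul_zero, add_zero] at h1
    refine ge_of_tendsto' h1 fun k => ?_
    obtain ⟨hmem, hle⟩ := hseg (ψ k)
    have hpos := (ht01 (ψ k)).1
    set s := t (ψ k)
    have h2 := hq.toReal_le hbot (hdom.symm ▸ hmem)
    rw [toReal_objective F hr.ne_bot hqd, toReal_objective F hr.ne_bot hmem] at h2
    have h3 := hF.le_of_mem_subdiff (hG _ hmem) q
    have e1 : q + s • (y - q) - x = (q - x) + s • (y - q) := by abel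
    have e2 : inner ℝ (q - x) (y - q) = -inner ℝ (x - q) (y - q) := by
      rw [← inner_neg_left, neg_sub]
    have e3 : q - (q + s • (y - q)) = -(s • (y - q)) := by abel
    have hc : 1 / (2 * c) = 1 / 2 * (1 / c) := by
      rw [one_div, one_div, one_div, mul_inv]
    rw [e1, norm_add_smul_sq, e2, hc] at h2
    rw [e3, inner_neg_right, inner_smul_right, norm_neg, norm_smul, mul_pow, Real.norm_eq_abs,
      sq_abs] at h3
    change _ ≤ (r y).toReal + inner ℝ (G (q + s • (y - q))) (y - q) + _
    rw [hc]
    refine le_of_mul_le_mul_left (a := s) ?_ hpos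
    nlinarith [h2, h3, hle]

end LimitingSubgradient

end

/-! ### Deterministic one-step inequalities. -/

section

variable {n : ℕ}

section Young

variable {V : Type*} [NormedAddCommGroup V] [InnerProductSpace ℝ V]

theorem two_mul_le_add_of_pos {c : ℝ} (hc : 0 < c) (x y : ℝ) :
    2 * (x * y) ≤ c * x ^ 2 + 1 / c * y ^ 2 := by
  have h : 0 ≤ 1 / c * (c * x - y) ^ 2 := by positivity
  have e : 1 / c * (c * x - y) ^ 2 = c * x ^ 2 - 2 * (x * y) + 1 / c * y ^ 2 := by
    field_simp
    ring
  linarith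

theorem norm_sub_sq_le_two (x y : V) : ‖x - y‖ ^ 2 ≤ 2 * (‖x‖ ^ 2 + ‖y‖ ^ 2) := by
  have h1 := norm_sub_sq_real x y
  have h2 := norm_add_sq_real x y
  have h3 := sq_nonneg ‖x + y‖
  linarith

theorem norm_add_sq_le_two (x y : V) : ‖x + y‖ ^ 2 ≤ 2 * (‖x‖ ^ 2 + ‖y‖ ^ 2) := by
  have h1 := norm_sub_sq_real x y
  have h2 := norm_add_sq_real x y
  have h3 := sq_nonneg ‖x - y‖
  linarith

end Young

variable {F : Vec n → ℝ} {r : Vec n → EReal} {ρ M : ℝ}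

/-- One step of the method decreases the potential `a φ(x) + (b/2) ‖x - xₚ‖²`, up to noise. -/
theorem potential_step_le (hF : WeaklyConvex ρ F) (hr : ClosedConvex r) {a b γ : ℝ} (ha : 0 < a)
    (hb : 0 ≤ b) (hγ : 0 < γ) (hγ2 : 2 * γ = 1 - a * ρ / 2 - b) {x x' xₚ g v : Vec n}
    (hx : x ∈ effDom r)
    (hstep : IsProx a r (x - a • g + b • (x - xₚ)) x') (hv : v ∈ subdiff F x') (hvM : ‖v‖ ≤ M) :
    a * (objective F r x').toReal + (γ + b / 2) * ‖x' - x‖ ^ 2 ≤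
      a * (objective F r x).toReal + b / 2 * ‖x - xₚ‖ ^ 2
        + a ^ 2 / (2 * γ) * (‖g‖ ^ 2 + M ^ 2) := by
  have hx' : x' ∈ effDom r := hstep.mem_effDom hx
  rw [toReal_objective F hr.ne_bot hx, toReal_objective F hr.ne_bot hx']
  have h1 := hF.le_of_mem_subdiff hv x
  have h2 := hstep.variational hr.ne_bot hr.segmentWeaklyConvex hx
  set D := x' - x with hD
  have e0 : x - x' = -D := by rw [hD, neg_sub]
  have e1 : x - a • g + b • (x - xₚ) - x' = -D - a • g + b • (x - xₚ) := by rw [hD]; abel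
  rw [e1, e0, inner_neg_right, norm_neg, inner_add_left, inner_sub_left, inner_neg_left,
    inner_smul_left, inner_smul_left, real_inner_self_eq_norm_sq] at h2
  simp only [conj_trivial] at h2
  rw [e0, inner_neg_right, norm_neg] at h1
  have h3 : a * (r x').toReal + ‖D‖ ^ 2 + a * inner ℝ g D - b * inner ℝ (x - xₚ) D ≤
      a * (r x).toReal := by
    have h4 := mul_le_mul_of_nonneg_left h2 ha.le
    have e2 : a * ((r x').toReal + 1 / a * -(-‖D‖ ^ 2 - a * inner ℝ g D + b * inner ℝ (x - xₚ) D)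
        - 0 / 2 * ‖D‖ ^ 2) =
        a * (r x').toReal + ‖D‖ ^ 2 + a * inner ℝ g D - b * inner ℝ (x - xₚ) D := by
      field_simp
      ring
    linarith
  have h5 : inner ℝ (x - xₚ) D ≤ 1 / 2 * (‖x - xₚ‖ ^ 2 + ‖D‖ ^ 2) := by
    nlinarith [real_inner_le_norm (x - xₚ) D, sq_nonneg (‖x - xₚ‖ - ‖D‖)]
  -- Weak convexity and inertia leave the surplus 2γ‖D‖² beyond the (b/2)‖D‖² of the new potential.
  -- Young's inequality spends half of it on the mismatch v - g.
  have h6 : a * inner ℝ (v - g) D ≤ γ * ‖D‖ ^ 2 + a ^ 2 / (2 * γ) * (‖g‖ ^ 2 + M ^ 2) := by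
    have h7 := two_mul_le_add_of_pos (c := 2 * γ) (by positivity) ‖D‖ (a * ‖v - g‖)
    have h8 : a * inner ℝ (v - g) D ≤ a * (‖v - g‖ * ‖D‖) :=
      mul_le_mul_of_nonneg_left (real_inner_le_norm _ _) ha.le
    have h9 : ‖v - g‖ ^ 2 ≤ 2 * (‖g‖ ^ 2 + M ^ 2) := by
      nlinarith [norm_sub_sq_le_two v g, norm_nonneg v]
    have h10 : 1 / (2 * γ) * (a * ‖v - g‖) ^ 2 ≤ 2 * (a ^ 2 / (2 * γ) * (‖g‖ ^ 2 + M ^ 2)) := by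
      calc 1 / (2 * γ) * (a * ‖v - g‖) ^ 2 = a ^ 2 / (2 * γ) * ‖v - g‖ ^ 2 := by ring
        _ ≤ a ^ 2 / (2 * γ) * (2 * (‖g‖ ^ 2 + M ^ 2)) :=
          mul_le_mul_of_nonneg_left h9 (by positivity)
        _ = _ := by ring
    linarith
  rw [inner_sub_left] at h6
  have h11 := mul_le_mul_of_nonneg_left h5 hb
  have h12 := mul_le_mul_of_nonneg_left h1 ha.le
  have h13 : γ * ‖D‖ ^ 2 = (1 - a * ρ / 2 - b - γ) * ‖D‖ ^ 2 := by rw [← hγ2]; ring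
  linarith

/-- One step of the method, measured from the proximal point `q` of `x`. -/
theorem sq_dist_prox_step_le (hF : WeaklyConvex ρ F) (hr : ClosedConvex r) {G : Vec n → Vec n}
    (hG : ∀ x ∈ effDom r, G x ∈ subdiff F x) (hGM : ∀ x ∈ effDom r, ‖G x‖ ≤ M)
    {ρ' a b : ℝ} (hρ' : ρ < ρ') (ha : 0 < a) (haρ : a * ρ' ≤ 1)
    {x x' xₚ q g : Vec n} (hx : x ∈ effDom r)
    (hstep : IsProx a r (x - a • g + b • (x - xₚ)) x')
    (hq : IsProx (1 / ρ') (objective F r) x q) :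
    ‖x' - q‖ ^ 2 ≤ (1 + a * (ρ' - ρ) / 2) * (1 - a * ρ') ^ 2 * ‖x - q‖ ^ 2
      + (2 + 2 / (a * (ρ' - ρ))) * (b ^ 2 * ‖x - xₚ‖ ^ 2)
      + 4 * a ^ 2 * (‖g‖ ^ 2 + M ^ 2)
      + 2 * a * (1 - a * ρ') * (F x - F q + ρ / 2 * ‖x - q‖ ^ 2 - inner ℝ (x - q) g) := by
  have hx' : x' ∈ effDom r := hstep.mem_effDom hx
  have hdom := effDom_objective F r
  have hqd : q ∈ effDom r := hdom ▸ hq.mem_effDom (hdom.symm ▸ hx)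
  obtain ⟨v, hvM, hv, hvopt⟩ := exists_bounded_subgradient hF hr hG hGM hq hx'
  have h1 := hstep.variational hr.ne_bot hr.segmentWeaklyConvex hqd
  rw [one_div_one_div] at hvopt
  set D := x' - q with hD
  set u := x - q with hu
  set Δ := x - xₚ with hΔ
  have e0 : q - x' = -D := by rw [hD, neg_sub]
  have e1 : x - a • g + b • Δ - x' = u - a • g + b • Δ - D := by rw [hD, hu]; abel
  -- Optimality of x' tested at q plus optimality of q tested at x' eliminates `r` and gives ‖D‖² ≤
  -- ⟨W, D⟩. Hence v need only certify q in the direction of x'.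
  set W := (1 - a * ρ') • u + (a • (v - g) + b • Δ) with hW
  have h2 : ‖D‖ ^ 2 ≤ inner ℝ W D := by
    rw [e1, e0, inner_neg_right, norm_neg, inner_sub_left, real_inner_self_eq_norm_sq] at h1
    have h3 : a * ((r x').toReal + 1 / a * -(inner ℝ (u - a • g + b • Δ) D - ‖D‖ ^ 2)
        - 0 / 2 * ‖D‖ ^ 2) = a * (r x').toReal - inner ℝ (u - a • g + b • Δ) D + ‖D‖ ^ 2 := by
      field_simp
      ring
    have h4 := mul_le_mul_of_nonneg_left h1 ha.le
    rw [h3] at h4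
    have h5 := mul_le_mul_of_nonneg_left hvopt ha.le
    have h6 : inner ℝ W D = inner ℝ (u - a • g + b • Δ) D - a * (ρ' * inner ℝ u D)
        + a * inner ℝ v D := by
      rw [hW]
      simp only [inner_add_left, inner_sub_left, inner_smul_left, conj_trivial]
      ring
    linarith
  have h3 : ‖D‖ ^ 2 ≤ ‖W‖ ^ 2 := by
    have h4 := h2.trans (real_inner_le_norm W D)
    nlinarith [sq_nonneg (‖W‖ - ‖D‖)]
  refine h3.trans ?_
  have hs : 0 < a * (ρ' - ρ) := mul_pos ha (by linarith)
  have h1t : 0 ≤ 1 - a * ρ' := by linarith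
  have h4 : ‖W‖ ^ 2 = (1 - a * ρ') ^ 2 * ‖u‖ ^ 2 + 2 * ((1 - a * ρ') * (a * inner ℝ u (v - g)))
      + 2 * ((1 - a * ρ') * (b * inner ℝ u Δ)) + ‖a • (v - g) + b • Δ‖ ^ 2 := by
    rw [hW, norm_add_sq_real, norm_smul, mul_pow, Real.norm_eq_abs, sq_abs, inner_smul_left,
      inner_add_right, inner_smul_right, inner_smul_right]
    simp only [conj_trivial]
    ring
  have h5 : ‖a • (v - g) + b • Δ‖ ^ 2 ≤ 4 * a ^ 2 * (‖g‖ ^ 2 + M ^ 2) + 2 * (b ^ 2 * ‖Δ‖ ^ 2) := by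
    have h6 := norm_add_sq_le_two (a • (v - g)) (b • Δ)
    rw [norm_smul, norm_smul, mul_pow, mul_pow, Real.norm_eq_abs, Real.norm_eq_abs, sq_abs,
      sq_abs] at h6
    have h7 : ‖v - g‖ ^ 2 ≤ 2 * (‖g‖ ^ 2 + M ^ 2) := by
      nlinarith [norm_sub_sq_le_two v g, norm_nonneg v]
    have h8 := mul_le_mul_of_nonneg_left h7 (sq_nonneg a)
    linarith
  -- The Young weight is half the contraction rate a(ρ' - ρ), so that the resulting multiple of ‖u‖²
  -- can be absorbed in `contraction_factor_le`.
  have h6 : 2 * ((1 - a * ρ') * (b * inner ℝ u Δ)) ≤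
      a * (ρ' - ρ) / 2 * (1 - a * ρ') ^ 2 * ‖u‖ ^ 2
        + 2 / (a * (ρ' - ρ)) * (b ^ 2 * ‖Δ‖ ^ 2) := by
    have h7 := two_mul_le_add_of_pos (c := a * (ρ' - ρ) / 2) (by positivity)
      ((1 - a * ρ') * ‖u‖) (|b| * ‖Δ‖)
    have h8 : b * inner ℝ u Δ ≤ |b| * (‖u‖ * ‖Δ‖) := by
      refine (le_abs_self _).trans ?_
      rw [abs_mul]
      exact mul_le_mul_of_nonneg_left (abs_real_inner_le_norm u Δ) (abs_nonneg b)
    have h9 := mul_le_mul_of_nonneg_left h8 h1t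
    rw [one_div_div, mul_pow, mul_pow, sq_abs] at h7
    linarith
  have h7 : inner ℝ u v ≤ F x - F q + ρ / 2 * ‖u‖ ^ 2 := by
    have h8 := hv x
    rw [real_inner_comm]
    linarith
  have h8 := mul_le_mul_of_nonneg_left h7 (mul_nonneg h1t ha.le)
  rw [h4, inner_sub_right]
  linarith

/-- Approximate monotonicity with a delayed subgradient. -/
theorem neg_inner_delayed_subgradient_le (hF : WeaklyConvex ρ F) {ρ' : ℝ} (hρ' : ρ < ρ')
    {x q y v : Vec n} (hv : v ∈ subdiff F y) (hvM : ‖v‖ ≤ M) :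
    F x - F q + ρ / 2 * ‖x - q‖ ^ 2 - inner ℝ (x - q) v ≤
      (ρ + (ρ' - ρ) / 4) * ‖x - q‖ ^ 2 + (F x - F y) + M * ‖x - y‖
        + (ρ / 2 + ρ ^ 2 / (ρ' - ρ)) * ‖x - y‖ ^ 2 := by
  have h1 := hF.le_of_mem_subdiff hv q
  set u := x - q with hu
  set w := x - y with hw
  have e1 : q - y = w - u := by rw [hu, hw]; abel
  rw [e1, norm_sub_sq_real, inner_sub_right] at h1
  have h2 : -inner ℝ v w ≤ M * ‖w‖ := by
    have h3 := neg_le_of_abs_le (abs_real_inner_le_norm v w)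
    have h4 := mul_le_mul_of_nonneg_right hvM (norm_nonneg w)
    linarith
  have h3 : -(ρ * inner ℝ w u) ≤ (ρ' - ρ) / 4 * ‖u‖ ^ 2 + ρ ^ 2 / (ρ' - ρ) * ‖w‖ ^ 2 := by
    have hs : 0 < ρ' - ρ := by linarith
    have h4 := two_mul_le_add_of_pos (c := (ρ' - ρ) / 2) (by positivity) ‖u‖ (ρ * ‖w‖)
    have h5 := neg_le_of_abs_le (abs_real_inner_le_norm w u)
    have h6 := mul_le_mul_of_nonneg_left h5 hF.1.le
    have e : 1 / ((ρ' - ρ) / 2) * (ρ * ‖w‖) ^ 2 = 2 * (ρ ^ 2 / (ρ' - ρ) * ‖w‖ ^ 2) := by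
      field_simp
    linarith
  rw [real_inner_comm]
  linarith

/-- The contraction factor of the quadratic term is at most `1 - a (ρ' - ρ)`. -/
theorem contraction_factor_le {ρ ρ' a : ℝ} (hρ : 0 < ρ) (hρ' : ρ < ρ') (ha : 0 < a)
    (haρ : a * ρ' ≤ 1) :
    (1 + a * (ρ' - ρ) / 2) * (1 - a * ρ') ^ 2
      + 2 * a * (1 - a * ρ') * (ρ + (ρ' - ρ) / 4) ≤ 1 - a * (ρ' - ρ) := by
  obtain ⟨t, ht⟩ : ∃ t, t = a * ρ' := ⟨_, rfl⟩
  obtain ⟨s, hs⟩ : ∃ s, s = a * (ρ' - ρ) := ⟨_, rfl⟩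
  have hs0 : 0 ≤ s := hs ▸ mul_nonneg ha.le (by linarith)
  have hst : s ≤ t := by rw [hs, ht]; nlinarith
  have ht1 : t ≤ 1 := ht ▸ haρ
  -- Here aρ = t - s. The remainder is nonnegative because ts ≤ s ≤ t.
  have e : 1 - s - ((1 + s / 2) * (1 - t) ^ 2 + 2 * (1 - t) * (t - s + s / 4)) =
      t * (t - s / 2 - t * s / 2) := by ring
  have h1 : 0 ≤ t * (t - s / 2 - t * s / 2) :=
    mul_nonneg (hs0.trans hst) (by nlinarith)
  have e2 : 2 * a * (1 - a * ρ') * (ρ + (ρ' - ρ) / 4) = 2 * (1 - t) * (t - s + s / 4) := by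
    rw [ht, hs]; ring
  rw [e2, ← hs, ← ht]
  linarith

/-- One step of the method decreases the Moreau envelope, up to inertia, delay and noise. -/
theorem moreauEnvelope_step_le (hF : WeaklyConvex ρ F) (hr : ClosedConvex r) {G : Vec n → Vec n}
    (hG : ∀ x ∈ effDom r, G x ∈ subdiff F x) (hGM : ∀ x ∈ effDom r, ‖G x‖ ≤ M)
    {ρ' a b : ℝ} (hρ' : ρ < ρ') (ha : 0 < a) (haρ : a * ρ' ≤ 1)
    {x x' xₚ q q' y g v : Vec n} (hx : x ∈ effDom r)
    (hv : v ∈ subdiff F y) (hvM : ‖v‖ ≤ M)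
    (hstep : IsProx a r (x - a • g + b • (x - xₚ)) x')
    (hq : IsProx (1 / ρ') (objective F r) x q) (hq' : IsProx (1 / ρ') (objective F r) x' q') :
    moreauEnvelope (1 / ρ') (objective F r) x' + ρ' / 2 * (a * (ρ' - ρ)) * ‖x - q‖ ^ 2 ≤
      moreauEnvelope (1 / ρ') (objective F r) x
        + ρ' / 2 * ((2 + 2 / (a * (ρ' - ρ))) * (b ^ 2 * ‖x - xₚ‖ ^ 2)
          + 4 * a ^ 2 * (‖g‖ ^ 2 + M ^ 2)
          + 2 * a * (1 - a * ρ') * (F x - F y + M * ‖x - y‖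
            + (ρ / 2 + ρ ^ 2 / (ρ' - ρ)) * ‖x - y‖ ^ 2 + inner ℝ (x - q) (v - g))) := by
  have hdom := effDom_objective F r
  have hbot := objective_ne_bot F hr.ne_bot
  have hxd : x ∈ effDom (objective F r) := hdom.symm ▸ hx
  -- The old proximal point q attains the envelope at x and is a competitor in the envelope at x',
  -- so φ(q) cancels and only the squared distances to q are compared.
  have h1 := hq'.moreauEnvelope_le hbot (hq.mem_effDom hxd)
  rw [hq.moreauEnvelope_eq hbot ⟨x, hxd⟩]
  have hc : 1 / (2 * (1 / ρ')) = ρ' / 2 := by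
    rw [mul_one_div, one_div_div]
  rw [hc, norm_sub_rev q x'] at h1
  rw [hc, norm_sub_rev q x]
  have h2 := sq_dist_prox_step_le hF hr hG hGM hρ' ha haρ hx hstep hq
  have h3 := neg_inner_delayed_subgradient_le hF hρ' (x := x) (q := q) hv hvM
  have h4 := mul_le_mul_of_nonneg_right (contraction_factor_le hF.1 hρ' ha haρ)
    (sq_nonneg ‖x - q‖)
  have h1t : 0 ≤ 2 * a * (1 - a * ρ') := mul_nonneg (by positivity) (by linarith)
  have h5 := mul_le_mul_of_nonneg_left h3 h1t
  have hρ'0 : 0 ≤ ρ' / 2 := by linarith [hF.1]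
  have h6 : ‖x' - q‖ ^ 2 ≤ (1 - a * (ρ' - ρ)) * ‖x - q‖ ^ 2
      + ((2 + 2 / (a * (ρ' - ρ))) * (b ^ 2 * ‖x - xₚ‖ ^ 2)
          + 4 * a ^ 2 * (‖g‖ ^ 2 + M ^ 2)
          + 2 * a * (1 - a * ρ') * (F x - F y + M * ‖x - y‖
            + (ρ / 2 + ρ ^ 2 / (ρ' - ρ)) * ‖x - y‖ ^ 2 + inner ℝ (x - q) (v - g))) := by
    rw [inner_sub_right]
    linarith
  have h7 := mul_le_mul_of_nonneg_left h6 hρ'0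
  linarith

end

/-! ### Independence, second moments, random indices and fresh samples. -/

section Independence

variable {Ω α β γ : Type*} {mΩ : MeasurableSpace Ω} {mα : MeasurableSpace α}
  {mβ : MeasurableSpace β} {mγ : MeasurableSpace γ} {P : Measure Ω} [IsProbabilityMeasure P]

/-- To be read with X the past, Y the new sample and Z the new delay: the delayed iterate depends on
past and delay jointly, and this pair must be independent of the sample. The triple has a product
law, whose factors are regrouped. -/
theorem indepFun_prodMk_left_of_prodMk_right {X : Ω → α} {Y : Ω → β} {Z : Ω → γ}
    (hX : Measurable X) (hY : Measurable Y) (hZ : Measurable Z)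
    (h : IndepFun X (fun ω => (Y ω, Z ω)) P) (hYZ : IndepFun Y Z P) :
    IndepFun (fun ω => (X ω, Z ω)) Y P := by
  have hXZ : IndepFun X Z P := h.comp measurable_id measurable_snd
  have : IsProbabilityMeasure (P.map X) := Measure.isProbabilityMeasure_map hX.aemeasurable
  have : IsProbabilityMeasure (P.map Y) := Measure.isProbabilityMeasure_map hY.aemeasurable
  have : IsProbabilityMeasure (P.map Z) := Measure.isProbabilityMeasure_map hZ.aemeasurable
  rw [indepFun_iff_map_prod_eq_prod_map_map (hX.prodMk hZ).aemeasurable hY.aemeasurable,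
    hXZ.map_prod_eq_prod_map_map hX.aemeasurable hZ.aemeasurable]
  have h1 := h.map_prod_eq_prod_map_map hX.aemeasurable (hY.prodMk hZ).aemeasurable
  rw [hYZ.map_prod_eq_prod_map_map hY.aemeasurable hZ.aemeasurable] at h1
  have hsw : MeasurePreserving (Prod.map id Prod.swap)
      ((P.map X).prod ((P.map Y).prod (P.map Z))) ((P.map X).prod ((P.map Z).prod (P.map Y))) :=
    (MeasurePreserving.id (P.map X)).prod Measure.measurePreserving_swap
  have has := (measurePreserving_prodAssoc (P.map X) (P.map Z) (P.map Y)).symm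
  have h2 := (has.comp hsw).map_eq
  rw [← h1, Measure.map_map (has.comp hsw).measurable (hX.prodMk (hY.prodMk hZ))] at h2
  exact h2

end Independence

section Moments

variable {Ω : Type*} [MeasurableSpace Ω] {P : Measure Ω} {n : ℕ}

theorem memLp_two_of_lintegral_le {s : Ω → Vec n} (hs : AEStronglyMeasurable s P) {C : ℝ}
    (hC : 0 ≤ C) (h : ∫⁻ ω, ‖s ω‖ₑ ^ 2 ∂P ≤ ENNReal.ofReal C) :
    MemLp s 2 P ∧ ∫ ω, ‖s ω‖ ^ 2 ∂P ≤ C := by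
  have e : ∀ ω, ENNReal.ofReal (‖s ω‖ ^ 2) = ‖s ω‖ₑ ^ 2 := fun ω => by
    rw [ENNReal.ofReal_pow (norm_nonneg _), ofReal_norm]
  constructor
  · rw [memLp_two_iff_integrable_sq_norm hs]
    refine ⟨hs.norm.pow 2, ?_⟩
    rw [hasFiniteIntegral_iff_ofReal (Eventually.of_forall fun ω => by positivity)]
    simp_rw [e]
    exact h.trans_lt ENNReal.ofReal_lt_top
  · rw [integral_eq_lintegral_of_nonneg_ae (f := fun ω => ‖s ω‖ ^ 2)
      (Eventually.of_forall fun ω => by positivity) (hs.norm.pow 2)]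
    simp_rw [e]
    exact ENNReal.toReal_le_of_le_ofReal hC h

theorem integrable_inner_of_memLp_two {s t : Ω → Vec n} (hs : MemLp s 2 P) (ht : MemLp t 2 P) :
    Integrable (fun ω => inner ℝ (s ω) (t ω)) P := by
  have hbd : Integrable (fun ω => ‖s ω‖ ^ 2 + ‖t ω‖ ^ 2) P :=
    hs.norm.integrable_sq.add ht.norm.integrable_sq
  refine hbd.mono' (hs.1.inner ht.1) (Eventually.of_forall fun ω => ?_)
  have h1 := abs_real_inner_le_norm (s ω) (t ω)
  rw [Real.norm_eq_abs]
  nlinarith [sq_nonneg (‖s ω‖ - ‖t ω‖), sq_nonneg ‖s ω‖, sq_nonneg ‖t ω‖]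

theorem sq_integral_le_integral_sq [IsProbabilityMeasure P] {X : Ω → ℝ} (hX : MemLp X 2 P) :
    (∫ ω, X ω ∂P) ^ 2 ≤ ∫ ω, X ω ^ 2 ∂P := by
  have h1 := variance_eq_sub hX
  have h2 := variance_nonneg X P
  simp only [Pi.pow_apply] at h1
  linarith

theorem norm_integral_le_of_sq [IsProbabilityMeasure P] {s : Ω → Vec n} (hs : MemLp s 2 P)
    {M : ℝ} (hM : 0 ≤ M) (h : ∫ ω, ‖s ω‖ ^ 2 ∂P ≤ M ^ 2) : ‖∫ ω, s ω ∂P‖ ≤ M := by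
  have h1 := sq_integral_le_integral_sq hs.norm
  have h2 := abs_le_of_sq_le_sq (h1.trans h) hM
  exact (norm_integral_le_integral_norm s).trans ((le_abs_self _).trans h2)

end Moments

section RandomIndex

variable {Ω : Type*} [MeasurableSpace Ω] {P : Measure Ω} [IsProbabilityMeasure P]

theorem ae_mem_finset_of_sum_eq_one {N : Ω → ℕ} (hN : Measurable N) (S : Finset ℕ)
    (hS : ∑ j ∈ S, P.real {ω | N ω = j} = 1) : ∀ᵐ ω ∂P, N ω ∈ S := by
  have h1 : P.real (⋃ j ∈ S, {ω | N ω = j}) = 1 := by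
    rw [measureReal_biUnion_finset, hS]
    · intro i _ j _ hij
      exact Set.disjoint_left.2 fun ω (h : N ω = i) (h' : N ω = j) => hij (h.symm.trans h')
    · exact fun j _ => hN (measurableSet_singleton j)
  have h2 : (⋃ j ∈ S, {ω | N ω = j}) = {ω | N ω ∈ S} := by
    ext ω
    simp
  rw [h2] at h1
  have hm : MeasurableSet {ω | N ω ∈ S} := hN S.measurableSet
  have h3 : P {ω | N ω ∈ S} = 1 := by
    rw [← ofReal_measureReal, h1, ENNReal.ofReal_one]
  exact (prob_compl_eq_zero_iff hm).2 h3

/-- Splitting over the values of N, each indicator is independent of the corresponding Φ. This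
serves both the random delays and the output index T. -/
theorem integral_comp_random_index {N : Ω → ℕ} (hN : Measurable N) (S : Finset ℕ)
    (hS : ∑ j ∈ S, P.real {ω | N ω = j} = 1) {Φ : ℕ → Ω → ℝ}
    (hint : ∀ j ∈ S, Integrable (Φ j) P) (hind : ∀ j ∈ S, IndepFun N (Φ j) P) :
    Integrable (fun ω => Φ (N ω) ω) P ∧
      ∫ ω, Φ (N ω) ω ∂P = ∑ j ∈ S, P.real {ω | N ω = j} * ∫ ω, Φ j ω ∂P := by
  set I : ℕ → Ω → ℝ := fun j ω => if N ω = j then 1 else 0 with hI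
  have hImeas : ∀ j, Measurable (I j) := fun j =>
    Measurable.ite (hN (measurableSet_singleton j)) measurable_const measurable_const
  have hIint : ∀ j, ∫ ω, I j ω ∂P = P.real {ω | N ω = j} := fun j => by
    have : I j = Set.indicator {ω | N ω = j} 1 := by
      funext ω
      simp [hI, Set.indicator_apply]
    rw [this]
    exact integral_indicator_one (hN (measurableSet_singleton j))
  have hIind : ∀ j ∈ S, IndepFun (I j) (Φ j) P := fun j hj =>
    (hind j hj).comp (φ := fun m => if m = j then (1 : ℝ) else 0) (Measurable.of_discrete)
      measurable_id
  have heq : (fun ω => Φ (N ω) ω) =ᵐ[P] fun ω => ∑ j ∈ S, I j ω * Φ j ω := by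
    filter_upwards [ae_mem_finset_of_sum_eq_one hN S hS] with ω hω
    simp [hI, hω]
  have hprod : ∀ j ∈ S, Integrable (fun ω => I j ω * Φ j ω) P := fun j hj => by
    refine (hint j hj).bdd_mul (c := 1) (hImeas j).aestronglyMeasurable
      (Eventually.of_forall fun ω => ?_)
    simp only [hI]
    split_ifs <;> simp
  refine ⟨(integrable_finsetSum S hprod).congr heq.symm, ?_⟩
  rw [integral_congr_ae heq, integral_finsetSum S hprod]
  refine Finset.sum_congr rfl fun j hj => ?_
  rw [(hIind j hj).integral_fun_mul_eq_mul_integral (hImeas j).aestronglyMeasurable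
    (hint j hj).aestronglyMeasurable, hIint]

end RandomIndex

section FreshSample

variable {Ω Ξ : Type*} [MeasurableSpace Ω] [MeasurableSpace Ξ] {P : Measure Ω}
  [IsProbabilityMeasure P] {μ : Measure Ξ} [IsProbabilityMeasure μ] {n : ℕ}

theorem lintegral_sq_fresh_sample_le {g : Vec n → Ξ → Vec n}
    (hg : Measurable (Function.uncurry g)) {Y : Ω → Vec n} {ζ : Ω → Ξ} (hY : Measurable Y)
    (hζ : Measurable ζ) (hlaw : P.map ζ = μ) (hind : IndepFun Y ζ P) {C : ENNReal}
    (hC : ∀ ω, ∫⁻ e, ‖g (Y ω) e‖ₑ ^ 2 ∂μ ≤ C) : ∫⁻ ω, ‖g (Y ω) (ζ ω)‖ₑ ^ 2 ∂P ≤ C := by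
  have hm : Measurable fun p : Vec n × Ξ => ‖g p.1 p.2‖ₑ ^ 2 := hg.enorm.pow_const 2
  have h1 := hind.map_prod_eq_prod_map_map hY.aemeasurable hζ.aemeasurable
  rw [hlaw] at h1
  have h2 : ∫⁻ ω, ‖g (Y ω) (ζ ω)‖ₑ ^ 2 ∂P = ∫⁻ ω, ∫⁻ e, ‖g (Y ω) e‖ₑ ^ 2 ∂μ ∂P := by
    calc ∫⁻ ω, ‖g (Y ω) (ζ ω)‖ₑ ^ 2 ∂P
        = ∫⁻ p, ‖g p.1 p.2‖ₑ ^ 2 ∂(P.map fun ω => (Y ω, ζ ω)) :=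
          (lintegral_map hm (hY.prodMk hζ)).symm
      _ = ∫⁻ y, ∫⁻ e, ‖g y e‖ₑ ^ 2 ∂μ ∂(P.map Y) := by
          rw [h1, lintegral_prod _ hm.aemeasurable]
      _ = _ := lintegral_map hm.lintegral_prod_right' hY
  rw [h2]
  calc ∫⁻ ω, ∫⁻ e, ‖g (Y ω) e‖ₑ ^ 2 ∂μ ∂P ≤ ∫⁻ _, C ∂P := lintegral_mono hC
    _ = C := by simp

/-- Conditional expectation in the form of Fubini: under the product law the sample is averaged with
(U, Y) frozen. -/
theorem integral_inner_fresh_sample {g : Vec n → Ξ → Vec n}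
    (hg : Measurable (Function.uncurry g)) {U Y : Ω → Vec n} {ζ : Ω → Ξ} (hU : Measurable U)
    (hY : Measurable Y) (hζ : Measurable ζ) (hlaw : P.map ζ = μ)
    (hind : IndepFun (fun ω => (U ω, Y ω)) ζ P)
    (hint : Integrable (fun ω => inner ℝ (U ω) (g (Y ω) (ζ ω))) P)
    (hgY : ∀ ω, Integrable (g (Y ω)) μ) :
    ∫ ω, inner ℝ (U ω) (g (Y ω) (ζ ω)) ∂P = ∫ ω, inner ℝ (U ω) (∫ e, g (Y ω) e ∂μ) ∂P := by
  have hm : Measurable fun p : (Vec n × Vec n) × Ξ => inner ℝ p.1.1 (g p.1.2 p.2) :=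
    (measurable_fst.comp measurable_fst).inner
      (hg.comp ((measurable_snd.comp measurable_fst).prodMk measurable_snd))
  have hUY : Measurable fun ω => (U ω, Y ω) := hU.prodMk hY
  have h1 := hind.map_prod_eq_prod_map_map hUY.aemeasurable hζ.aemeasurable
  rw [hlaw] at h1
  have hint' : Integrable (fun p : (Vec n × Vec n) × Ξ => inner ℝ p.1.1 (g p.1.2 p.2))
      ((P.map fun ω => (U ω, Y ω)).prod μ) := by
    rw [← h1, integrable_map_measure hm.aestronglyMeasurable (hUY.prodMk hζ).aemeasurable]
    exact hint
  calc ∫ ω, inner ℝ (U ω) (g (Y ω) (ζ ω)) ∂P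
      = ∫ p, inner ℝ p.1.1 (g p.1.2 p.2) ∂(P.map fun ω => ((U ω, Y ω), ζ ω)) :=
        (integral_map (hUY.prodMk hζ).aemeasurable hm.aestronglyMeasurable).symm
    _ = ∫ q, ∫ e, inner ℝ q.1 (g q.2 e) ∂μ ∂(P.map fun ω => (U ω, Y ω)) := by
        rw [h1, integral_prod _ hint']
    _ = ∫ ω, ∫ e, inner ℝ (U ω) (g (Y ω) e) ∂μ ∂P :=
        integral_map hUY.aemeasurable
          hm.stronglyMeasurable.integral_prod_right'.aestronglyMeasurable
    _ = _ := by
        refine integral_congr_ae (Eventually.of_forall fun ω => ?_)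
        exact integral_inner (hgY ω) (U ω)

end FreshSample

/-! ### Iterates as functions of the past: measurability and square integrability. -/

section

variable {n : ℕ}

/-- Iterates are specified only by the relation `IsProx`. Uniqueness turns it into a Lipschitz map,
which transports measurability and square integrability from one step to the next. -/
theorem exists_lipschitz_proxMap {h : Vec n → EReal} {c ρ m : ℝ}
    (hlsc : LowerSemicontinuous h) (hm : ∀ x, (m : EReal) ≤ h x)
    (hne : (effDom h).Nonempty) (hconv : SegmentWeaklyConvex ρ h) (hc : 0 < c)
    (hcρ : ρ < 1 / c) :
    ∃ (L : NNReal) (pr : Vec n → Vec n), LipschitzWith L pr ∧ (∀ z, IsProx c h z (pr z)) ∧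
      ∀ z y, IsProx c h z y → y = pr z := by
  have hbot : ∀ x, h x ≠ ⊥ := fun x => ne_of_gt ((EReal.bot_lt_coe m).trans_le (hm x))
  choose pr hpr using exists_isProx hlsc hm hne hc
  have hL : 0 ≤ 1 / c / (1 / c - ρ) := by
    have : 0 < 1 / c - ρ := by linarith
    positivity
  refine ⟨⟨1 / c / (1 / c - ρ), hL⟩, pr, LipschitzWith.of_dist_le_mul fun z z' => ?_, hpr,
    fun z y hy => ?_⟩
  · rw [dist_eq_norm, dist_eq_norm]
    exact (hpr z).dist_le hbot hconv hne hc hcρ (hpr z')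
  · have h1 := hy.dist_le hbot hconv hne hc hcρ (hpr z)
    rw [sub_self, norm_zero, mul_zero] at h1
    exact sub_eq_zero.1 (norm_le_zero_iff.1 h1)

theorem memLp_lipschitz_comp {Ω : Type*} [MeasurableSpace Ω] {P : Measure Ω}
    [IsProbabilityMeasure P] {L : NNReal} {pr : Vec n → Vec n} (hpr : LipschitzWith L pr)
    {z : Ω → Vec n} (hz : MemLp z 2 P) : MemLp (fun ω => pr (z ω)) 2 P := by
  have hA : MemLp (fun _ : Ω => ‖pr 0‖) 2 P := memLp_const _
  have hB : MemLp (fun ω => (L : ℝ) * ‖z ω‖) 2 P := hz.norm.const_mul _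
  have h1 : MemLp (fun ω => ‖pr 0‖ + (L : ℝ) * ‖z ω‖) 2 P := hA.add hB
  refine h1.of_le (hpr.continuous.comp_aestronglyMeasurable hz.1)
    (Eventually.of_forall fun ω => ?_)
  have h2 := hpr.dist_le_mul (z ω) 0
  rw [dist_eq_norm, dist_zero_right] at h2
  have h3 := norm_le_norm_add_norm_sub' (pr (z ω)) (pr 0)
  exact (h3.trans (by linarith)).trans (le_abs_self _)

section Past

variable {Ω Ξ : Type*} [MeasurableSpace Ξ] {K : ℕ}

/-- The σ-algebra generated by the samples and delays of the steps before step `k`. -/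
@[reducible]
def pastSigma (ξ : ℕ → Ω → Ξ) (d : ℕ → Ω → ℕ) (K k : ℕ) : MeasurableSpace Ω :=
  ⨆ i ∈ {i : Set.Icc 1 K | i.1 < k},
    MeasurableSpace.comap (fun ω => (ξ i.1 ω, d i.1 ω)) inferInstance

variable {ξ : ℕ → Ω → Ξ} {d : ℕ → Ω → ℕ}

theorem measurable_pair_pastSigma {i k : ℕ} (hi : i ∈ Set.Icc 1 K) (hik : i < k) :
    Measurable[pastSigma ξ d K k] fun ω => (ξ i ω, d i ω) := by
  rw [measurable_iff_comap_le]
  exact le_biSup (f := fun i : Set.Icc 1 K =>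
    MeasurableSpace.comap (fun ω => (ξ i.1 ω, d i.1 ω)) inferInstance)
    (i := ⟨i, hi⟩) (show (⟨i, hi⟩ : Set.Icc 1 K) ∈ {i : Set.Icc 1 K | i.1 < k} from hik)

theorem measurable_delayed {β : Type*} [MeasurableSpace β] {m : MeasurableSpace Ω}
    {Φ : ℕ → Ω → β} (hΦ : ∀ j, Measurable (Φ j)) {N : Ω → ℕ} (hN : Measurable N) :
    Measurable fun ω => Φ (N ω) ω := by
  have h1 : Measurable fun p : Ω × ℕ => Φ p.2 p.1 := measurable_from_prod_countable_left hΦ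
  exact h1.comp (measurable_id.prodMk hN)

variable [mΩ : MeasurableSpace Ω] {P : Measure Ω} {μ : Measure Ξ} {τ : ℕ} {p : ℕ → ℝ}

theorem IsSampling.measurable_pair (h : IsSampling P μ τ p K ξ d) (i : Set.Icc 1 K) :
    Measurable fun ω => (ξ i.1 ω, d i.1 ω) :=
  (h.measurable_sample i i.2).prodMk (h.measurable_delay i i.2)

theorem IsSampling.pastSigma_le (h : IsSampling P μ τ p K ξ d) (k : ℕ) :
    pastSigma ξ d K k ≤ mΩ :=
  iSup₂_le fun i _ => (h.measurable_pair i).comap_le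

theorem IsSampling.indep_past [IsProbabilityMeasure P] (h : IsSampling P μ τ p K ξ d) {k : ℕ}
    (hk : k ∈ Set.Icc 1 K) :
    Indep (pastSigma ξ d K k)
      (MeasurableSpace.comap (fun ω => (ξ k ω, d k ω)) inferInstance) P := by
  have h1 := indep_iSup_of_disjoint (S := {i : Set.Icc 1 K | i.1 < k}) (T := {⟨k, hk⟩})
    (fun i => (h.measurable_pair i).comap_le) h.indep_steps (by
      rw [Set.disjoint_singleton_right]
      exact fun h' : k < k => lt_irrefl k h')
  simpa [pastSigma] using h1

theorem IsSampling.indepFun_past [IsProbabilityMeasure P] (h : IsSampling P μ τ p K ξ d) {k : ℕ}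
    (hk : k ∈ Set.Icc 1 K) {β : Type*} {mβ : MeasurableSpace β} {U : Ω → β}
    (hU : Measurable[pastSigma ξ d K k] U) : IndepFun U (fun ω => (ξ k ω, d k ω)) P :=
  (IndepFun_iff_Indep _ _ _).2 (indep_of_indep_of_le_left (h.indep_past hk) hU.comap_le)

theorem IsSampling.indepFun_delayed [IsProbabilityMeasure P] (h : IsSampling P μ τ p K ξ d)
    {k : ℕ} (hk : k ∈ Set.Icc 1 K) {β : Type*} [MeasurableSpace β] {Φ : ℕ → Ω → β}
    (hΦ : ∀ j, Measurable[pastSigma ξ d K k] (Φ j)) :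
    IndepFun (fun ω => Φ (d k ω) ω) (ξ k) P := by
  -- The whole past is treated as one random variable: the identity, with values in Ω equipped with
  -- the past σ-algebra.
  have h0 : Measurable[mΩ, pastSigma ξ d K k] (id : Ω → Ω) := measurable_id'' (h.pastSigma_le k)
  have h1 : @IndepFun Ω Ω (Ξ × ℕ) mΩ (pastSigma ξ d K k) _ id (fun ω => (ξ k ω, d k ω)) P :=
    h.indepFun_past hk (@measurable_id _ (pastSigma ξ d K k))
  have h2 := @indepFun_prodMk_left_of_prodMk_right Ω Ω Ξ ℕ mΩ (pastSigma ξ d K k) _ _ P _ id (ξ k)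
    (d k) h0 (h.measurable_sample k hk) (h.measurable_delay k hk) h1 (h.indep_sample_delay k hk)
  have h3 : @Measurable (Ω × ℕ) β (@Prod.instMeasurableSpace Ω ℕ (pastSigma ξ d K k) _) _
      fun q => Φ q.2 q.1 :=
    @measurable_from_prod_countable_left Ω ℕ β (pastSigma ξ d K k) _ _ _ _ _ hΦ
  exact h2.comp h3 measurable_id

theorem IsSampling.sum_delay (h : IsSampling P μ τ p K ξ d) {k : ℕ} (hk : k ∈ Set.Icc 1 K) :
    ∑ j ∈ Finset.range (τ + 1), P.real {ω | d k ω = j} = 1 := by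
  rw [← h.sum_law_delay]
  exact Finset.sum_congr rfl fun j hj =>
    h.law_delay k hk j (Nat.lt_succ_iff.1 (Finset.mem_range.1 hj))

theorem IsSampling.ae_delay_le [IsProbabilityMeasure P] (h : IsSampling P μ τ p K ξ d) {k : ℕ}
    (hk : k ∈ Set.Icc 1 K) : ∀ᵐ ω ∂P, d k ω ≤ τ := by
  filter_upwards [ae_mem_finset_of_sum_eq_one (h.measurable_delay k hk) _ (h.sum_delay hk)]
    with ω hω
  exact Nat.lt_succ_iff.1 (Finset.mem_range.1 hω)

theorem IsRandomIndex.indepFun_iterate {a : ℕ → ℝ} {T : Ω → ℕ} (h : IsRandomIndex P a K ξ d T)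
    {β : Type*} [MeasurableSpace β] {k : ℕ} {U : Ω → β}
    (hU : Measurable[pastSigma ξ d K k] U) : IndepFun T U P := by
  have h1 : pastSigma ξ d K k ≤ MeasurableSpace.comap
      (fun ω (i : Set.Icc 1 K) => (ξ i ω, d i ω)) inferInstance := by
    refine iSup₂_le fun i _ => ?_
    have h2 : (fun ω => (ξ i.1 ω, d i.1 ω)) =
        (fun q : Set.Icc 1 K → Ξ × ℕ => q i) ∘ fun ω (i : Set.Icc 1 K) => (ξ i ω, d i ω) := rfl
    rw [h2, ← MeasurableSpace.comap_comp]
    exact MeasurableSpace.comap_mono (measurable_pi_apply i).comap_le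
  exact (IndepFun_iff_Indep _ _ _).2 (indep_of_indep_of_le_right
    ((IndepFun_iff_Indep _ _ _).1 h.indep) (hU.comap_le.trans h1))

end Past

section Iterates

variable {Ω Ξ : Type*} {r : Vec n → EReal} {g : ℕ → Vec n → Ξ → Vec n}
  {a b : ℕ → ℝ} {ξ : ℕ → Ω → Ξ} {d : ℕ → Ω → ℕ} {K : ℕ} {x₀ : Vec n} {x : ℕ → Ω → Vec n}

theorem IsIterateSequence.mem_effDom (hx : IsIterateSequence r g a b ξ d K x₀ x) {k : ℕ}
    (hk : k ≤ K + 1) (ω : Ω) : x k ω ∈ effDom r := by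
  rcases Nat.lt_or_ge k 2 with h | h
  · interval_cases k
    · rw [hx.zero]; exact hx.start_mem
    · rw [hx.one]; exact hx.start_mem
  · obtain ⟨m, rfl⟩ : ∃ m, k = m + 1 := ⟨k - 1, by omega⟩
    exact (hx.step m ⟨by omega, by omega⟩ ω).mem_effDom hx.start_mem

/-- The induction is strong because a delay may reach back to any earlier iterate. Keeping `l` free
lets all of them be measured by the same σ-algebra. -/
theorem IsIterateSequence.measurable_pastSigma [MeasurableSpace Ξ]
    (hx : IsIterateSequence r g a b ξ d K x₀ x)
    (hg : ∀ k ∈ Set.Icc 1 K, Measurable (Function.uncurry (g k)))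
    (hpr : ∀ k ∈ Set.Icc 1 K, ∃ pr : Vec n → Vec n, Continuous pr ∧
      ∀ z y, IsProx (a k) r z y → y = pr z) :
    ∀ k ≤ K + 1, ∀ l, k ≤ l → Measurable[pastSigma ξ d K l] (x k) := by
  intro k
  induction k using Nat.strong_induction_on with
  | _ k ih =>
    intro hk l hl
    rcases Nat.lt_or_ge k 2 with h | h
    · have hconst : x k = fun _ => x₀ := by
        funext ω
        interval_cases k
        · exact hx.zero ω
        · exact hx.one ω
      rw [hconst]
      exact @measurable_const _ _ _ (pastSigma ξ d K l) _
    · obtain ⟨m, rfl⟩ : ∃ m, k = m + 1 := ⟨k - 1, by omega⟩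
      have hm : m ∈ Set.Icc 1 K := ⟨by omega, by omega⟩
      obtain ⟨pr, hcont, huniq⟩ := hpr m hm
      let _ := pastSigma ξ d K l
      have hpair := measurable_pair_pastSigma (ξ := ξ) (d := d) hm (show m < l by omega)
      have hpast : ∀ j ≤ m, Measurable (x j) := fun j hj =>
        ih j (by omega) (by omega) l (by omega)
      have hY : Measurable fun ω => x (m - d m ω) ω :=
        measurable_delayed (Φ := fun j => x (m - j)) (fun j => hpast _ (Nat.sub_le m j))
          (measurable_snd.comp hpair)
      have hgm : Measurable fun ω => g m (x (m - d m ω) ω) (ξ m ω) :=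
        (hg m hm).comp (hY.prodMk (measurable_fst.comp hpair))
      have hz : Measurable fun ω => x m ω - a m • g m (x (m - d m ω) ω) (ξ m ω)
          + b m • (x m ω - x (m - 1) ω) :=
        ((hpast m le_rfl).sub (hgm.const_smul (a m))).add
          (((hpast m le_rfl).sub (hpast (m - 1) (Nat.sub_le _ _))).const_smul (b m))
      have heq : x (m + 1) = fun ω => pr (x m ω - a m • g m (x (m - d m ω) ω) (ξ m ω)
          + b m • (x m ω - x (m - 1) ω)) := by
        funext ω
        exact huniq _ _ (hx.step m hm ω)
      rw [heq]
      exact hcont.measurable.comp hz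

variable [mΩ : MeasurableSpace Ω] {P : Measure Ω} [IsProbabilityMeasure P]

theorem IsIterateSequence.memLp (hx : IsIterateSequence r g a b ξ d K x₀ x)
    (hpr : ∀ k ∈ Set.Icc 1 K, ∃ (L : NNReal) (pr : Vec n → Vec n), LipschitzWith L pr ∧
      ∀ z y, IsProx (a k) r z y → y = pr z)
    (hg : ∀ k ∈ Set.Icc 1 K, MemLp (fun ω => g k (x (k - d k ω) ω) (ξ k ω)) 2 P) :
    ∀ k ≤ K + 1, MemLp (x k) 2 P := by
  intro k
  induction k using Nat.strong_induction_on with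
  | _ k ih =>
    intro hk
    rcases Nat.lt_or_ge k 2 with h | h
    · have hconst : x k = fun _ => x₀ := by
        funext ω
        interval_cases k
        · exact hx.zero ω
        · exact hx.one ω
      rw [hconst]
      exact memLp_const _
    · obtain ⟨m, rfl⟩ : ∃ m, k = m + 1 := ⟨k - 1, by omega⟩
      have hm : m ∈ Set.Icc 1 K := ⟨by omega, by omega⟩
      obtain ⟨L, pr, hlip, huniq⟩ := hpr m hm
      have hxm := ih m (by omega) (by omega)
      have hz : MemLp (fun ω => x m ω - a m • g m (x (m - d m ω) ω) (ξ m ω)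
          + b m • (x m ω - x (m - 1) ω)) 2 P :=
        (hxm.sub ((hg m hm).const_smul (a m))).add
          ((hxm.sub (ih (m - 1) (by omega) (by omega))).const_smul (b m))
      have heq : x (m + 1) = fun ω => pr (x m ω - a m • g m (x (m - d m ω) ω) (ξ m ω)
          + b m • (x m ω - x (m - 1) ω)) := by
        funext ω
        exact huniq _ _ (hx.step m hm ω)
      rw [heq]
      exact memLp_lipschitz_comp hlip hz

end Iterates

end

/-! ### Telescoping and delayed sums. -/

section Sums

theorem sum_Icc_sub_one_add (f : ℕ → ℝ) (K : ℕ) :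
    ∑ k ∈ Finset.Icc 1 K, f (k - 1) + f K = ∑ k ∈ Finset.Icc 1 K, f k + f 0 := by
  induction K with
  | zero => simp
  | succ K ih =>
    rw [Finset.sum_Icc_succ_top (by omega), Finset.sum_Icc_succ_top (by omega),
      Nat.add_sub_cancel]
    linarith

/-- Truncated indices all read f 0 = 0, so shifting back by one only removes a nonnegative top term.
-/
theorem sum_Icc_delayed_le {f : ℕ → ℝ} (hf : ∀ k, 0 ≤ f k) (hf0 : f 0 = 0) (K i : ℕ) :
    ∑ k ∈ Finset.Icc 1 K, f (k - i) ≤ ∑ k ∈ Finset.Icc 1 K, f k := by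
  induction i with
  | zero => simp
  | succ i ih =>
    have h1 := sum_Icc_sub_one_add (fun k => f (k - i)) K
    simp only [Nat.zero_sub, hf0, add_zero] at h1
    have h2 : ∑ k ∈ Finset.Icc 1 K, f (k - (i + 1)) = ∑ k ∈ Finset.Icc 1 K, f (k - 1 - i) :=
      Finset.sum_congr rfl fun k _ => by rw [Nat.sub_sub, add_comm]
    rw [h2]
    linarith [hf (K - i)]

/-- Each further unit of delay adds exactly f(K - j) - f(0), so an upper bound on f is enough and
the total does not grow with K. -/
theorem sum_Icc_sub_delayed_le {f : ℕ → ℝ} {C : ℝ} {K : ℕ} (hf : ∀ k ≤ K, f k ≤ C) (j : ℕ) :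
    ∑ k ∈ Finset.Icc 1 K, (f k - f (k - j)) ≤ j * (C - f 0) := by
  induction j with
  | zero => simp
  | succ j ih =>
    have h1 := sum_Icc_sub_one_add (fun k => f (k - j)) K
    simp only [Nat.zero_sub] at h1
    have h2 : ∑ k ∈ Finset.Icc 1 K, f (k - (j + 1)) = ∑ k ∈ Finset.Icc 1 K, f (k - 1 - j) :=
      Finset.sum_congr rfl fun k _ => by rw [Nat.sub_sub, add_comm]
    rw [Finset.sum_sub_distrib] at ih ⊢
    rw [h2]
    push_cast
    linarith [hf (K - j) (Nat.sub_le K j)]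

theorem norm_sub_delayed_le {V : Type*} [NormedAddCommGroup V] (y : ℕ → V) (k : ℕ) {j τ : ℕ}
    (hj : j ≤ τ) : ‖y k - y (k - j)‖ ≤ ∑ i ∈ Finset.range τ, ‖y (k - i) - y (k - i - 1)‖ := by
  have h1 : ‖y k - y (k - j)‖ ≤ ∑ i ∈ Finset.range j, ‖y (k - i) - y (k - i - 1)‖ := by
    clear hj
    induction j with
    | zero => simp
    | succ j ih =>
      rw [Finset.sum_range_succ]
      have h2 := norm_sub_le_norm_sub_add_norm_sub (y k) (y (k - j)) (y (k - (j + 1)))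
      rw [← Nat.sub_sub] at h2 ⊢
      linarith
  exact h1.trans (Finset.sum_le_sum_of_subset_of_nonneg
    (Finset.range_subset_range.2 hj) fun i _ _ => norm_nonneg _)

theorem sq_norm_sub_delayed_le {V : Type*} [NormedAddCommGroup V] (y : ℕ → V) (k : ℕ) {j τ : ℕ}
    (hj : j ≤ τ) :
    ‖y k - y (k - j)‖ ^ 2 ≤ τ * ∑ i ∈ Finset.range τ, ‖y (k - i) - y (k - i - 1)‖ ^ 2 := by
  have h1 := pow_le_pow_left₀ (norm_nonneg _) (norm_sub_delayed_le y k hj) 2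
  refine h1.trans ?_
  have h2 := sq_sum_le_card_mul_sum_sq (s := Finset.range τ)
    (f := fun i => ‖y (k - i) - y (k - i - 1)‖)
  rwa [Finset.card_range] at h2

/-- Telescoping takes place pathwise before integration, so the potential itself, which contains `r`
in one application, need not be integrable. -/
theorem sum_integral_le_of_telescope {Ω : Type*} [MeasurableSpace Ω] {P : Measure Ω}
    [IsProbabilityMeasure P] {K : ℕ} {pot s m : ℕ → Ω → ℝ} {c c' : ℝ}
    (hs : ∀ k ∈ Finset.Icc 1 K, Integrable (s k) P)
    (hm : ∀ k ∈ Finset.Icc 1 K, Integrable (m k) P)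
    (hstep : ∀ k ∈ Finset.Icc 1 K, ∀ ω, pot (k + 1) ω + s k ω ≤ pot k ω + m k ω)
    (hfirst : ∀ ω, pot 1 ω = c) (hlast : ∀ ω, c' ≤ pot (K + 1) ω) :
    ∑ k ∈ Finset.Icc 1 K, ∫ ω, s k ω ∂P ≤ c - c' + ∑ k ∈ Finset.Icc 1 K, ∫ ω, m k ω ∂P := by
  have hpath : ∀ ω, ∑ k ∈ Finset.Icc 1 K, s k ω ≤ (c - c') + ∑ k ∈ Finset.Icc 1 K, m k ω := by
    intro ω
    have h1 : ∀ N ≤ K, pot (N + 1) ω + ∑ k ∈ Finset.Icc 1 N, s k ω ≤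
        pot 1 ω + ∑ k ∈ Finset.Icc 1 N, m k ω := by
      intro N
      induction N with
      | zero => simp
      | succ N ih =>
        intro hN
        rw [Finset.sum_Icc_succ_top (by omega), Finset.sum_Icc_succ_top (by omega)]
        have h2 := ih (by omega)
        have h3 := hstep (N + 1) (Finset.mem_Icc.2 ⟨by omega, hN⟩) ω
        linarith
    have h2 := h1 K le_rfl
    rw [hfirst] at h2
    linarith [hlast ω]
  rw [← integral_finsetSum _ hs, ← integral_finsetSum _ hm]
  have hmi := integrable_finsetSum _ hm
  calc ∫ ω, ∑ k ∈ Finset.Icc 1 K, s k ω ∂P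
      ≤ ∫ ω, ((c - c') + ∑ k ∈ Finset.Icc 1 K, m k ω) ∂P :=
        integral_mono (integrable_finsetSum _ hs) ((integrable_const _).add hmi) hpath
    _ = _ := by
        rw [integral_add (integrable_const _) hmi]
        simp

end Sums

/-! ### Moments, losses and noise along a run. -/

/-- A run of the method with constant step size and inertia, with the properties of the oracle
that the convergence analysis uses. -/
structure IsInertialRun {n : ℕ} {Ξ Ω : Type*} [MeasurableSpace Ξ] [MeasurableSpace Ω]
    (P : Measure Ω) (μ : Measure Ξ) (F : Vec n → ℝ) (r : Vec n → EReal) (ρ M a b : ℝ)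
    (g : ℕ → Vec n → Ξ → Vec n) (ξ : ℕ → Ω → Ξ) (d : ℕ → Ω → ℕ) (τ : ℕ) (p : ℕ → ℝ) (K : ℕ)
    (x₀ : Vec n) (x : ℕ → Ω → Vec n) : Prop where
  weaklyConvex : WeaklyConvex ρ F
  closedConvex : ClosedConvex r
  bddBelow : ∃ m : ℝ, ∀ y, (m : EReal) ≤ r y
  step_pos : 0 < a
  bound_nonneg : 0 ≤ M
  oracle_measurable : ∀ k ∈ Set.Icc 1 K, Measurable (Function.uncurry (g k))
  oracle_sq_le : ∀ k ∈ Set.Icc 1 K, ∀ y ∈ effDom r,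
    ∫⁻ e, ‖g k y e‖ₑ ^ 2 ∂μ ≤ ENNReal.ofReal (M ^ 2)
  oracle_mean_mem : ∀ k ∈ Set.Icc 1 K, ∀ y ∈ effDom r, ∫ e, g k y e ∂μ ∈ subdiff F y
  sampling : IsSampling P μ τ p K ξ d
  iterates : IsIterateSequence r g (fun _ => a) (fun _ => b) ξ d K x₀ x

namespace IsInertialRun

variable {n : ℕ} {Ξ Ω : Type*} [MeasurableSpace Ξ] [MeasurableSpace Ω]
  {P : Measure Ω} {μ : Measure Ξ} {F : Vec n → ℝ} {r : Vec n → EReal} {ρ M a b : ℝ}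
  {g : ℕ → Vec n → Ξ → Vec n} {ξ : ℕ → Ω → Ξ} {d : ℕ → Ω → ℕ} {τ : ℕ} {p : ℕ → ℝ} {K : ℕ}
  {x₀ : Vec n} {x : ℕ → Ω → Vec n}

theorem exists_prox (h : IsInertialRun P μ F r ρ M a b g ξ d τ p K x₀ x) :
    ∃ (L : NNReal) (pr : Vec n → Vec n), LipschitzWith L pr ∧ (∀ z, IsProx a r z (pr z)) ∧
      ∀ z y, IsProx a r z y → y = pr z := by
  obtain ⟨m, hm⟩ := h.bddBelow
  exact exists_lipschitz_proxMap h.closedConvex.lsc hm ⟨x₀, h.iterates.start_mem⟩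
    h.closedConvex.segmentWeaklyConvex h.step_pos (one_div_pos.2 h.step_pos)

theorem measurable_iterate_past (h : IsInertialRun P μ F r ρ M a b g ξ d τ p K x₀ x)
    {k l : ℕ} (hk : k ≤ K + 1) (hkl : k ≤ l) : Measurable[pastSigma ξ d K l] (x k) := by
  obtain ⟨L, pr, hL, -, hu⟩ := h.exists_prox
  exact h.iterates.measurable_pastSigma h.oracle_measurable
    (fun _ _ => ⟨pr, hL.continuous, hu⟩) k hk l hkl

theorem measurable_iterate (h : IsInertialRun P μ F r ρ M a b g ξ d τ p K x₀ x)
    {k : ℕ} (hk : k ≤ K + 1) : Measurable (x k) :=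
  (h.measurable_iterate_past hk le_rfl).mono (h.sampling.pastSigma_le k) le_rfl

theorem measurable_delayed_iterate (h : IsInertialRun P μ F r ρ M a b g ξ d τ p K x₀ x)
    {k : ℕ} (hk : k ∈ Set.Icc 1 K) : Measurable fun ω => x (k - d k ω) ω :=
  measurable_delayed (Φ := fun j => x (k - j))
    (fun j => h.measurable_iterate ((Nat.sub_le k j).trans (hk.2.trans (Nat.le_succ K))))
    (h.sampling.measurable_delay k hk)

theorem delayed_mem_effDom (h : IsInertialRun P μ F r ρ M a b g ξ d τ p K x₀ x)
    {k : ℕ} (hk : k ∈ Set.Icc 1 K) (ω : Ω) : x (k - d k ω) ω ∈ effDom r :=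
  h.iterates.mem_effDom ((Nat.sub_le k _).trans (hk.2.trans (Nat.le_succ K))) ω

theorem oracle_memLp (h : IsInertialRun P μ F r ρ M a b g ξ d τ p K x₀ x) {k : ℕ}
    (hk : k ∈ Set.Icc 1 K) {y : Vec n} (hy : y ∈ effDom r) :
    MemLp (g k y) 2 μ ∧ ∫ e, ‖g k y e‖ ^ 2 ∂μ ≤ M ^ 2 :=
  memLp_two_of_lintegral_le
    ((h.oracle_measurable k hk).comp measurable_prodMk_left).aestronglyMeasurable
    (sq_nonneg M) (h.oracle_sq_le k hk y hy)

theorem norm_oracle_mean_le [IsProbabilityMeasure μ]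
    (h : IsInertialRun P μ F r ρ M a b g ξ d τ p K x₀ x) {k : ℕ}
    (hk : k ∈ Set.Icc 1 K) {y : Vec n} (hy : y ∈ effDom r) : ‖∫ e, g k y e ∂μ‖ ≤ M :=
  norm_integral_le_of_sq (h.oracle_memLp hk hy).1 h.bound_nonneg (h.oracle_memLp hk hy).2

theorem measurable_sample_subgradient (h : IsInertialRun P μ F r ρ M a b g ξ d τ p K x₀ x)
    {k : ℕ} (hk : k ∈ Set.Icc 1 K) : Measurable fun ω => g k (x (k - d k ω) ω) (ξ k ω) :=
  (h.oracle_measurable k hk).comp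
    ((h.measurable_delayed_iterate hk).prodMk (h.sampling.measurable_sample k hk))

theorem indepFun_delayed_iterate [IsProbabilityMeasure P]
    (h : IsInertialRun P μ F r ρ M a b g ξ d τ p K x₀ x)
    {k : ℕ} (hk : k ∈ Set.Icc 1 K) {pr : Vec n → Vec n} (hpr : Measurable pr) :
    IndepFun (fun ω => (pr (x k ω), x (k - d k ω) ω)) (ξ k) P := by
  refine h.sampling.indepFun_delayed hk (Φ := fun j ω => (pr (x k ω), x (k - j) ω)) fun j => ?_
  have hk' : k ≤ K + 1 := hk.2.trans (Nat.le_succ K)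
  exact (hpr.comp (h.measurable_iterate_past hk' le_rfl)).prodMk
    (h.measurable_iterate_past ((Nat.sub_le k j).trans hk') (Nat.sub_le k j))

variable [IsProbabilityMeasure P] [IsProbabilityMeasure μ]

theorem sample_subgradient_memLp (h : IsInertialRun P μ F r ρ M a b g ξ d τ p K x₀ x)
    {k : ℕ} (hk : k ∈ Set.Icc 1 K) :
    MemLp (fun ω => g k (x (k - d k ω) ω) (ξ k ω)) 2 P ∧
      ∫ ω, ‖g k (x (k - d k ω) ω) (ξ k ω)‖ ^ 2 ∂P ≤ M ^ 2 := by
  refine memLp_two_of_lintegral_le (h.measurable_sample_subgradient hk).aestronglyMeasurable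
    (sq_nonneg M) ?_
  exact lintegral_sq_fresh_sample_le (h.oracle_measurable k hk) (h.measurable_delayed_iterate hk)
    (h.sampling.measurable_sample k hk) (h.sampling.law_sample k hk)
    ((h.indepFun_delayed_iterate hk measurable_id).comp measurable_snd measurable_id)
    fun ω => h.oracle_sq_le k hk _ (h.delayed_mem_effDom hk ω)

theorem iterate_memLp (h : IsInertialRun P μ F r ρ M a b g ξ d τ p K x₀ x) {k : ℕ}
    (hk : k ≤ K + 1) : MemLp (x k) 2 P := by
  obtain ⟨L, pr, hL, -, hu⟩ := h.exists_prox
  exact h.iterates.memLp (fun _ _ => ⟨L, pr, hL, hu⟩)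
    (fun k hk => (h.sample_subgradient_memLp hk).1) k hk

theorem increment_memLp (h : IsInertialRun P μ F r ρ M a b g ξ d τ p K x₀ x) {k : ℕ}
    (hk : k ≤ K + 1) : MemLp (fun ω => x k ω - x (k - 1) ω) 2 P :=
  (h.iterate_memLp hk).sub (h.iterate_memLp ((Nat.sub_le k 1).trans hk))

/-- The subgradient inequalities at x₀ and at x_k, with oracle means of norm at most M, bound
|F(x_k) - F(x₀)| by M‖x_k - x₀‖ + (ρ/2)‖x_k - x₀‖². -/
theorem integrable_loss_iterate (h : IsInertialRun P μ F r ρ M a b g ξ d τ p K x₀ x)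
    (hK : 1 ≤ K) {k : ℕ} (hk : k ≤ K + 1) : Integrable (fun ω => F (x k ω)) P := by
  have h1 : (1 : ℕ) ∈ Set.Icc 1 K := ⟨le_rfl, hK⟩
  have hD : MemLp (fun ω => x k ω - x₀) 2 P := (h.iterate_memLp hk).sub (memLp_const x₀)
  have hbd : Integrable (fun ω => |F x₀| + M * ‖x k ω - x₀‖ + ρ / 2 * ‖x k ω - x₀‖ ^ 2) P :=
    ((integrable_const _).add ((hD.norm.integrable one_le_two).const_mul M)).add
      (hD.norm.integrable_sq.const_mul _)
  refine hbd.mono' (h.weaklyConvex.continuous.measurable.comp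
    (h.measurable_iterate hk)).aestronglyMeasurable (Eventually.of_forall fun ω => ?_)
  have hx₀ := h.iterates.start_mem
  have hxk := h.iterates.mem_effDom hk ω
  have h2 := h.weaklyConvex.le_of_mem_subdiff (h.oracle_mean_mem 1 h1 x₀ hx₀) (x k ω)
  have h3 := h.weaklyConvex.le_of_mem_subdiff (h.oracle_mean_mem 1 h1 _ hxk) x₀
  have h4 := neg_le_of_abs_le (abs_real_inner_le_norm (∫ e, g 1 x₀ e ∂μ) (x k ω - x₀))
  have h5 := neg_le_of_abs_le (abs_real_inner_le_norm (∫ e, g 1 (x k ω) e ∂μ) (x₀ - x k ω))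
  have h6 := mul_le_mul_of_nonneg_right (h.norm_oracle_mean_le h1 hx₀) (norm_nonneg (x k ω - x₀))
  have h7 := mul_le_mul_of_nonneg_right (h.norm_oracle_mean_le h1 hxk) (norm_nonneg (x₀ - x k ω))
  rw [norm_sub_rev x₀ (x k ω)] at h3 h5 h7
  rw [Real.norm_eq_abs, abs_le]
  constructor <;> linarith [le_abs_self (F x₀), neg_abs_le (F x₀)]

theorem integral_loss_delayed (h : IsInertialRun P μ F r ρ M a b g ξ d τ p K x₀ x)
    {k : ℕ} (hk : k ∈ Set.Icc 1 K) :
    Integrable (fun ω => F (x (k - d k ω) ω)) P ∧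
      ∫ ω, F (x (k - d k ω) ω) ∂P =
        ∑ j ∈ Finset.range (τ + 1), p j * ∫ ω, F (x (k - j) ω) ∂P := by
  have hk' : ∀ j, k - j ≤ K + 1 := fun j => (Nat.sub_le k j).trans (hk.2.trans (Nat.le_succ K))
  have h1 := integral_comp_random_index (h.sampling.measurable_delay k hk) _
    (h.sampling.sum_delay hk) (Φ := fun j ω => F (x (k - j) ω))
    (fun j _ => h.integrable_loss_iterate (hk.1.trans hk.2) (hk' j)) (fun j _ => by
      have h2 := h.sampling.indepFun_past hk
        (h.measurable_iterate_past (hk' j) (Nat.sub_le k j))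
      exact (h2.comp h.weaklyConvex.continuous.measurable measurable_snd).symm)
  refine ⟨h1.1, h1.2.trans (Finset.sum_congr rfl fun j hj => ?_)⟩
  rw [h.sampling.law_delay k hk j (Nat.lt_succ_iff.1 (Finset.mem_range.1 hj))]

/-- The vector x_k - pr(x_k) is determined by the past and the delayed point by past and delay; both
are independent of the sample of step k. -/
theorem integral_noise (h : IsInertialRun P μ F r ρ M a b g ξ d τ p K x₀ x)
    {k : ℕ} (hk : k ∈ Set.Icc 1 K) {L : NNReal} {pr : Vec n → Vec n} (hpr : LipschitzWith L pr) :
    Integrable (fun ω => inner ℝ (x k ω - pr (x k ω))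
      (∫ e, g k (x (k - d k ω) ω) e ∂μ - g k (x (k - d k ω) ω) (ξ k ω))) P ∧
    ∫ ω, inner ℝ (x k ω - pr (x k ω))
      (∫ e, g k (x (k - d k ω) ω) e ∂μ - g k (x (k - d k ω) ω) (ξ k ω)) ∂P = 0 := by
  have hk' : k ≤ K + 1 := hk.2.trans (Nat.le_succ K)
  have hxm := h.iterate_memLp hk'
  have hU : MemLp (fun ω => x k ω - pr (x k ω)) 2 P := hxm.sub (memLp_lipschitz_comp hpr hxm)
  have hUm : Measurable fun ω => x k ω - pr (x k ω) :=
    (h.measurable_iterate hk').sub (hpr.continuous.measurable.comp (h.measurable_iterate hk'))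
  have hmean : MemLp (fun ω => ∫ e, g k (x (k - d k ω) ω) e ∂μ) 2 P := by
    refine MemLp.of_bound (C := M) ?_ (Eventually.of_forall fun ω =>
      h.norm_oracle_mean_le hk (h.delayed_mem_effDom hk ω))
    have h1 := (h.oracle_measurable k hk).stronglyMeasurable.integral_prod_right' (ν := μ)
    exact (h1.comp_measurable (h.measurable_delayed_iterate hk)).aestronglyMeasurable
  have hint1 : Integrable (fun ω => inner ℝ (x k ω - pr (x k ω))
      (∫ e, g k (x (k - d k ω) ω) e ∂μ)) P := integrable_inner_of_memLp_two hU hmean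
  have hint2 : Integrable (fun ω => inner ℝ (x k ω - pr (x k ω))
      (g k (x (k - d k ω) ω) (ξ k ω))) P :=
    integrable_inner_of_memLp_two hU (h.sample_subgradient_memLp hk).1
  simp_rw [inner_sub_right]
  refine ⟨hint1.sub hint2, ?_⟩
  rw [integral_sub hint1 hint2, sub_eq_zero]
  refine (integral_inner_fresh_sample (h.oracle_measurable k hk) hUm
    (h.measurable_delayed_iterate hk) (h.sampling.measurable_sample k hk)
    (h.sampling.law_sample k hk) ?_ hint2 fun ω => ?_).symm
  · exact h.indepFun_delayed_iterate hk (pr := fun y => y - pr y)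
      (measurable_id.sub hpr.continuous.measurable)
  · exact (h.oracle_memLp hk (h.delayed_mem_effDom hk ω)).1.integrable one_le_two

end IsInertialRun

/-! ### Estimates in expectation summed over all steps. -/

namespace IsInertialRun

variable {n : ℕ} {Ξ Ω : Type*} [MeasurableSpace Ξ] [MeasurableSpace Ω]
  {P : Measure Ω} {μ : Measure Ξ} {F : Vec n → ℝ} {r : Vec n → EReal} {ρ M a b : ℝ}
  {g : ℕ → Vec n → Ξ → Vec n} {ξ : ℕ → Ω → Ξ} {d : ℕ → Ω → ℕ} {τ : ℕ} {p : ℕ → ℝ} {K : ℕ}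
  {x₀ : Vec n} {x : ℕ → Ω → Vec n} [IsProbabilityMeasure P] [IsProbabilityMeasure μ]

/-- The first Lyapunov function, telescoped; the mean of the first oracle supplies the bounded
subgradient at x_{k+1}. For a = α/√K the bound is B. -/
theorem sum_increment_succ_le (h : IsInertialRun P μ F r ρ M a b g ξ d τ p K x₀ x) (hK : 1 ≤ K)
    (hbdd : optValue (objective F r) ≠ ⊥) (hb : 0 ≤ b) {γ : ℝ} (hγ : 0 < γ)
    (hγ2 : 2 * γ = 1 - a * ρ / 2 - b) :
    ∑ k ∈ Finset.Icc 1 K, ∫ ω, ‖x (k + 1) ω - x k ω‖ ^ 2 ∂P ≤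
      a / γ * ((objective F r x₀).toReal - (optValue (objective F r)).toReal)
        + K * a ^ 2 * M ^ 2 / γ ^ 2 := by
  have ha := h.step_pos
  have h1K : (1 : ℕ) ∈ Set.Icc 1 K := ⟨le_rfl, hK⟩
  have hg2 : ∀ k ∈ Finset.Icc 1 K,
      Integrable (fun ω => ‖g k (x (k - d k ω) ω) (ξ k ω)‖ ^ 2) P := fun k hk =>
    (h.sample_subgradient_memLp (Finset.mem_Icc.1 hk)).1.norm.integrable_sq
  have hD : ∀ k ∈ Finset.Icc 1 K, Integrable (fun ω => ‖x (k + 1) ω - x k ω‖ ^ 2) P :=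
    fun k hk => (h.increment_memLp (k := k + 1)
      (by have := (Finset.mem_Icc.1 hk).2; omega)).norm.integrable_sq
  have key := sum_integral_le_of_telescope (P := P) (K := K)
    (pot := fun k ω => a * (objective F r (x k ω)).toReal + b / 2 * ‖x k ω - x (k - 1) ω‖ ^ 2)
    (s := fun k ω => γ * ‖x (k + 1) ω - x k ω‖ ^ 2)
    (m := fun k ω => a ^ 2 / (2 * γ) * (‖g k (x (k - d k ω) ω) (ξ k ω)‖ ^ 2 + M ^ 2))
    (c := a * (objective F r x₀).toReal) (c' := a * (optValue (objective F r)).toReal)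
    (fun k hk => (hD k hk).const_mul γ)
    (fun k hk => ((hg2 k hk).add (integrable_const _)).const_mul _)
    (fun k hk ω => by
      have hk' : k ∈ Set.Icc 1 K := Finset.mem_Icc.1 hk
      have hx' := h.iterates.mem_effDom (k := k + 1) (by have := hk'.2; omega) ω
      have := potential_step_le h.weaklyConvex h.closedConvex ha hb hγ hγ2
        (h.iterates.mem_effDom (hk'.2.trans (Nat.le_succ K)) ω) (h.iterates.step k hk' ω)
        (h.oracle_mean_mem 1 h1K _ hx') (h.norm_oracle_mean_le h1K hx')
      simp only [Nat.add_sub_cancel]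
      linarith)
    (fun ω => by simp [h.iterates.one, h.iterates.zero])
    (fun ω => by
      have hx' : x (K + 1) ω ∈ effDom (objective F r) := by
        rw [effDom_objective]
        exact h.iterates.mem_effDom le_rfl ω
      have h1 := mul_le_mul_of_nonneg_left (toReal_optValue_le hbdd hx') ha.le
      have h2 : 0 ≤ b / 2 * ‖x (K + 1) ω - x (K + 1 - 1) ω‖ ^ 2 := by positivity
      linarith)
  have hm : ∀ k ∈ Finset.Icc 1 K,
      ∫ ω, a ^ 2 / (2 * γ) * (‖g k (x (k - d k ω) ω) (ξ k ω)‖ ^ 2 + M ^ 2) ∂P ≤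
        a ^ 2 * M ^ 2 / γ := fun k hk => by
    rw [integral_const_mul, integral_add (hg2 k hk) (integrable_const _)]
    simp only [integral_const, probReal_univ, one_smul]
    have h1 := (h.sample_subgradient_memLp (Finset.mem_Icc.1 hk)).2
    calc _ ≤ a ^ 2 / (2 * γ) * (M ^ 2 + M ^ 2) :=
          mul_le_mul_of_nonneg_left (by linarith) (by positivity)
      _ = _ := by field_simp; ring
  have h2 := key.trans (add_le_add_right (Finset.sum_le_sum hm) _)
  simp only [integral_const_mul, Finset.sum_const, Nat.card_Icc, Nat.add_sub_cancel,
    nsmul_eq_mul] at h2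
  rw [← Finset.mul_sum] at h2
  refine le_of_mul_le_mul_left (h2.trans (le_of_eq ?_)) hγ
  field_simp

theorem sum_increment_le (h : IsInertialRun P μ F r ρ M a b g ξ d τ p K x₀ x) (hK : 1 ≤ K)
    (hbdd : optValue (objective F r) ≠ ⊥) (hb : 0 ≤ b) {γ : ℝ} (hγ : 0 < γ)
    (hγ2 : 2 * γ = 1 - a * ρ / 2 - b) :
    ∑ k ∈ Finset.Icc 1 K, ∫ ω, ‖x k ω - x (k - 1) ω‖ ^ 2 ∂P ≤
      a / γ * ((objective F r x₀).toReal - (optValue (objective F r)).toReal)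
        + K * a ^ 2 * M ^ 2 / γ ^ 2 := by
  refine le_trans ?_ (h.sum_increment_succ_le hK hbdd hb hγ hγ2)
  have h1 := sum_Icc_sub_one_add (fun k => ∫ ω, ‖x (k + 1) ω - x k ω‖ ^ 2 ∂P) K
  have h2 : ∑ k ∈ Finset.Icc 1 K, ∫ ω, ‖x k ω - x (k - 1) ω‖ ^ 2 ∂P =
      ∑ k ∈ Finset.Icc 1 K, ∫ ω, ‖x (k - 1 + 1) ω - x (k - 1) ω‖ ^ 2 ∂P :=
    Finset.sum_congr rfl fun k hk => by
      rw [Nat.sub_add_cancel (Finset.mem_Icc.1 hk).1]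
  have h3 : ∫ ω, ‖x (0 + 1) ω - x 0 ω‖ ^ 2 ∂P = 0 := by
    simp [h.iterates.one, h.iterates.zero]
  have h4 : 0 ≤ ∫ ω, ‖x (K + 1) ω - x K ω‖ ^ 2 ∂P := integral_nonneg fun ω => by positivity
  rw [h2]
  simp only [h3, add_zero] at h1
  linarith

theorem delay_le (h : IsInertialRun P μ F r ρ M a b g ξ d τ p K x₀ x) {k : ℕ}
    (hk : k ∈ Set.Icc 1 K) :
    Integrable (fun ω => ‖x k ω - x (k - d k ω) ω‖) P ∧
    ∫ ω, ‖x k ω - x (k - d k ω) ω‖ ∂P ≤ ∑ i ∈ Finset.range τ,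
      √(∫ ω, ‖x (k - i) ω - x (k - i - 1) ω‖ ^ 2 ∂P) := by
  have hki : ∀ i, k - i ≤ K + 1 := fun i => (Nat.sub_le k i).trans (hk.2.trans (Nat.le_succ K))
  have hi : ∀ i ∈ Finset.range τ, Integrable (fun ω => ‖x (k - i) ω - x (k - i - 1) ω‖) P :=
    fun i _ => (h.increment_memLp (hki i)).norm.integrable one_le_two
  have hsum := integrable_finsetSum _ hi
  have hle : ∀ᵐ ω ∂P, ‖x k ω - x (k - d k ω) ω‖ ≤
      ∑ i ∈ Finset.range τ, ‖x (k - i) ω - x (k - i - 1) ω‖ := by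
    filter_upwards [h.sampling.ae_delay_le hk] with ω hω
    exact norm_sub_delayed_le (fun j => x j ω) k hω
  have hmeas : Measurable fun ω => ‖x k ω - x (k - d k ω) ω‖ :=
    ((h.measurable_iterate (hki 0)).sub (h.measurable_delayed_iterate hk)).norm
  have hint : Integrable (fun ω => ‖x k ω - x (k - d k ω) ω‖) P := by
    refine hsum.mono' hmeas.aestronglyMeasurable ?_
    filter_upwards [hle] with ω hω
    rwa [norm_norm]
  refine ⟨hint, (integral_mono_ae hint hsum hle).trans ?_⟩
  rw [integral_finsetSum _ hi]
  refine Finset.sum_le_sum fun i _ => ?_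
  exact (le_abs_self _).trans
    (Real.abs_le_sqrt (sq_integral_le_integral_sq (h.increment_memLp (hki i)).norm))

theorem sq_delay_le (h : IsInertialRun P μ F r ρ M a b g ξ d τ p K x₀ x) {k : ℕ}
    (hk : k ∈ Set.Icc 1 K) :
    Integrable (fun ω => ‖x k ω - x (k - d k ω) ω‖ ^ 2) P ∧
    ∫ ω, ‖x k ω - x (k - d k ω) ω‖ ^ 2 ∂P ≤ τ * ∑ i ∈ Finset.range τ,
      ∫ ω, ‖x (k - i) ω - x (k - i - 1) ω‖ ^ 2 ∂P := by
  have hki : ∀ i, k - i ≤ K + 1 := fun i => (Nat.sub_le k i).trans (hk.2.trans (Nat.le_succ K))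
  have hi : ∀ i ∈ Finset.range τ, Integrable (fun ω => ‖x (k - i) ω - x (k - i - 1) ω‖ ^ 2) P :=
    fun i _ => (h.increment_memLp (hki i)).norm.integrable_sq
  have hsum := (integrable_finsetSum _ hi).const_mul (τ : ℝ)
  have hle : ∀ᵐ ω ∂P, ‖x k ω - x (k - d k ω) ω‖ ^ 2 ≤
      τ * ∑ i ∈ Finset.range τ, ‖x (k - i) ω - x (k - i - 1) ω‖ ^ 2 := by
    filter_upwards [h.sampling.ae_delay_le hk] with ω hω
    exact sq_norm_sub_delayed_le (fun j => x j ω) k hω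
  have hmeas : Measurable fun ω => ‖x k ω - x (k - d k ω) ω‖ ^ 2 :=
    ((h.measurable_iterate (hki 0)).sub (h.measurable_delayed_iterate hk)).norm.pow_const 2
  have hint : Integrable (fun ω => ‖x k ω - x (k - d k ω) ω‖ ^ 2) P := by
    refine hsum.mono' hmeas.aestronglyMeasurable ?_
    filter_upwards [hle] with ω hω
    rwa [Real.norm_of_nonneg (by positivity)]
  refine ⟨hint, (integral_mono_ae hint hsum hle).trans (le_of_eq ?_)⟩
  rw [integral_const_mul, integral_finsetSum _ hi]

/-- Cauchy–Schwarz over k produces the factor √K, which the stepsize later absorbs through a√K = α.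
-/
theorem sum_delay_le (h : IsInertialRun P μ F r ρ M a b g ξ d τ p K x₀ x) {B : ℝ}
    (hB : ∑ k ∈ Finset.Icc 1 K, ∫ ω, ‖x k ω - x (k - 1) ω‖ ^ 2 ∂P ≤ B) :
    ∑ k ∈ Finset.Icc 1 K, ∫ ω, ‖x k ω - x (k - d k ω) ω‖ ∂P ≤ τ * (√K * √B) := by
  set δ : ℕ → ℝ := fun k => ∫ ω, ‖x k ω - x (k - 1) ω‖ ^ 2 ∂P with hδ
  have hδ0 : ∀ k, 0 ≤ δ k := fun k => integral_nonneg fun ω => by positivity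
  have hCS : ∑ k ∈ Finset.Icc 1 K, √(δ k) ≤ √K * √B := by
    rw [← Real.sqrt_mul (Nat.cast_nonneg K)]
    refine (le_abs_self _).trans (Real.abs_le_sqrt ?_)
    have h1 := sq_sum_le_card_mul_sum_sq (s := Finset.Icc 1 K) (f := fun k => √(δ k))
    simp only [Nat.card_Icc, Nat.add_sub_cancel, Real.sq_sqrt (hδ0 _)] at h1
    exact h1.trans (mul_le_mul_of_nonneg_left hB (Nat.cast_nonneg K))
  calc _ ≤ ∑ k ∈ Finset.Icc 1 K, ∑ i ∈ Finset.range τ, √(δ (k - i)) :=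
        Finset.sum_le_sum fun k hk => (h.delay_le (Finset.mem_Icc.1 hk)).2
    _ = ∑ i ∈ Finset.range τ, ∑ k ∈ Finset.Icc 1 K, √(δ (k - i)) := Finset.sum_comm
    _ ≤ ∑ i ∈ Finset.range τ, √K * √B := Finset.sum_le_sum fun i _ =>
        (sum_Icc_delayed_le (f := fun k => √(δ k)) (fun k => Real.sqrt_nonneg _)
          (by simp [hδ]) K i).trans hCS
    _ = _ := by simp

theorem sum_sq_delay_le (h : IsInertialRun P μ F r ρ M a b g ξ d τ p K x₀ x) {B : ℝ}
    (hB : ∑ k ∈ Finset.Icc 1 K, ∫ ω, ‖x k ω - x (k - 1) ω‖ ^ 2 ∂P ≤ B) :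
    ∑ k ∈ Finset.Icc 1 K, ∫ ω, ‖x k ω - x (k - d k ω) ω‖ ^ 2 ∂P ≤ τ * (τ * B) := by
  set δ : ℕ → ℝ := fun k => ∫ ω, ‖x k ω - x (k - 1) ω‖ ^ 2 ∂P with hδ
  have hδ0 : ∀ k, 0 ≤ δ k := fun k => integral_nonneg fun ω => by positivity
  calc _ ≤ ∑ k ∈ Finset.Icc 1 K, τ * ∑ i ∈ Finset.range τ, δ (k - i) :=
        Finset.sum_le_sum fun k hk => (h.sq_delay_le (Finset.mem_Icc.1 hk)).2
    _ = τ * ∑ i ∈ Finset.range τ, ∑ k ∈ Finset.Icc 1 K, δ (k - i) := by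
        rw [← Finset.mul_sum, Finset.sum_comm]
    _ ≤ τ * ∑ i ∈ Finset.range τ, B := by
        refine mul_le_mul_of_nonneg_left (Finset.sum_le_sum fun i _ => ?_) (Nat.cast_nonneg τ)
        exact (sum_Icc_delayed_le hδ0 (by simp [hδ]) K i).trans hB
    _ = _ := by simp

/-- Independence of the delay from the past writes the delayed loss as a p-average of fixed shifts.
As p does not depend on k, the sums can be exchanged, and for each fixed shift j ≤ τ the sum over k
telescopes. -/
theorem sum_loss_sub_delayed_le (h : IsInertialRun P μ F r ρ M a b g ξ d τ p K x₀ x) (hK : 1 ≤ K)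
    {C : ℝ} (hC : ∀ y ∈ effDom r, F y ≤ C) :
    ∑ k ∈ Finset.Icc 1 K, (∫ ω, F (x k ω) ∂P - ∫ ω, F (x (k - d k ω) ω) ∂P) ≤
      τ * (C - F x₀) := by
  set f : ℕ → ℝ := fun k => ∫ ω, F (x k ω) ∂P with hf
  have hf0 : f 0 = F x₀ := by simp [hf, h.iterates.zero]
  have hfC : ∀ k ≤ K, f k ≤ C := fun k hk => by
    have hk' : k ≤ K + 1 := hk.trans (Nat.le_succ K)
    have h1 := integral_mono (h.integrable_loss_iterate hK hk') (integrable_const C)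
      fun ω => hC _ (h.iterates.mem_effDom hk' ω)
    simpa using h1
  have hpnonneg : ∀ j ∈ Finset.range (τ + 1), 0 ≤ p j := fun j hj => by
    rw [← h.sampling.law_delay 1 ⟨le_rfl, hK⟩ j (Nat.lt_succ_iff.1 (Finset.mem_range.1 hj))]
    exact measureReal_nonneg
  have hCF : 0 ≤ C - F x₀ := sub_nonneg.2 (hC _ h.iterates.start_mem)
  calc _ = ∑ k ∈ Finset.Icc 1 K, ∑ j ∈ Finset.range (τ + 1), p j * (f k - f (k - j)) := by
        refine Finset.sum_congr rfl fun k hk => ?_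
        rw [(h.integral_loss_delayed (Finset.mem_Icc.1 hk)).2]
        simp only [mul_sub, Finset.sum_sub_distrib, ← Finset.sum_mul, h.sampling.sum_law_delay,
          one_mul, hf]
    _ = ∑ j ∈ Finset.range (τ + 1), p j * ∑ k ∈ Finset.Icc 1 K, (f k - f (k - j)) := by
        rw [Finset.sum_comm]
        simp only [Finset.mul_sum]
    _ ≤ ∑ j ∈ Finset.range (τ + 1), p j * (τ * (C - F x₀)) := by
        refine Finset.sum_le_sum fun j hj => mul_le_mul_of_nonneg_left ?_ (hpnonneg j hj)
        refine (sum_Icc_sub_delayed_le hfC j).trans ?_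
        rw [hf0]
        refine mul_le_mul_of_nonneg_right ?_ hCF
        exact_mod_cast Nat.lt_succ_iff.1 (Finset.mem_range.1 hj)
    _ = _ := by rw [← Finset.sum_mul, h.sampling.sum_law_delay, one_mul]

/-- The averaged squared proximal residual of the iterates. -/
theorem sum_sq_residual_le (h : IsInertialRun P μ F r ρ M a b g ξ d τ p K x₀ x) (hK : 1 ≤ K)
    (hbdd : optValue (objective F r) ≠ ⊥) {C B ρ' : ℝ} (hC : ∀ y ∈ effDom r, F y ≤ C)
    (hρ' : ρ < ρ') (haρ : a * ρ' ≤ 1)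
    (hB : ∑ k ∈ Finset.Icc 1 K, ∫ ω, ‖x k ω - x (k - 1) ω‖ ^ 2 ∂P ≤ B)
    {L : NNReal} {pr : Vec n → Vec n} (hlip : LipschitzWith L pr)
    (hpr : ∀ y, IsProx (1 / ρ') (objective F r) y (pr y)) :
    ρ' / 2 * (a * (ρ' - ρ)) * ∑ k ∈ Finset.Icc 1 K, ∫ ω, ‖x k ω - pr (x k ω)‖ ^ 2 ∂P ≤
      ρ' / 2 * (2 + 2 / (a * (ρ' - ρ))) * b ^ 2 * B + 4 * ρ' * M ^ 2 * (K * a ^ 2)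
        + a * ρ' * τ * (C - F x₀ + τ * (ρ / 2 + ρ ^ 2 / (ρ' - ρ)) * B)
        + (moreauEnvelope (1 / ρ') (objective F r) x₀ - (optValue (objective F r)).toReal)
        + M * a * ρ' * τ * (√K * √B) := by
  have ha := h.step_pos
  have hρ := h.weaklyConvex.1
  have hρ'0 : 0 < ρ' := hρ.trans hρ'
  have hM := h.bound_nonneg
  have h1K : (1 : ℕ) ∈ Set.Icc 1 K := ⟨le_rfl, hK⟩
  have hbot := objective_ne_bot F h.closedConvex.ne_bot
  have hx₀ : x₀ ∈ effDom (objective F r) := by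
    rw [effDom_objective]
    exact h.iterates.start_mem
  set c₁ := 2 + 2 / (a * (ρ' - ρ)) with hc₁
  set c₃ := 2 * a * (1 - a * ρ') with hc₃
  set c₄ := ρ / 2 + ρ ^ 2 / (ρ' - ρ) with hc₄
  have hs : 0 < ρ' - ρ := by linarith
  have hc₁0 : 0 ≤ c₁ := by positivity
  have hc₃0 : 0 ≤ c₃ := mul_nonneg (by positivity) (by linarith)
  have hc₃a : c₃ ≤ 2 * a := by
    have : 0 ≤ a * (a * ρ') := by positivity
    rw [hc₃]; linarith
  have hc₄0 : 0 ≤ c₄ := by positivity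
  have hk1 : ∀ k ∈ Finset.Icc 1 K, k ≤ K + 1 := fun k hk =>
    (Finset.mem_Icc.1 hk).2.trans (Nat.le_succ K)
  have hU : ∀ k ∈ Finset.Icc 1 K, Integrable (fun ω => ‖x k ω - pr (x k ω)‖ ^ 2) P :=
    fun k hk => ((h.iterate_memLp (hk1 k hk)).sub
      (memLp_lipschitz_comp hlip (h.iterate_memLp (hk1 k hk)))).norm.integrable_sq
  have hD : ∀ k ∈ Finset.Icc 1 K, Integrable (fun ω => ‖x k ω - x (k - 1) ω‖ ^ 2) P :=
    fun k hk => (h.increment_memLp (hk1 k hk)).norm.integrable_sq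
  have hg2 : ∀ k ∈ Finset.Icc 1 K,
      Integrable (fun ω => ‖g k (x (k - d k ω) ω) (ξ k ω)‖ ^ 2) P := fun k hk =>
    (h.sample_subgradient_memLp (Finset.mem_Icc.1 hk)).1.norm.integrable_sq
  have hg3 : ∀ k ∈ Finset.Icc 1 K,
      Integrable (fun ω => ‖g k (x (k - d k ω) ω) (ξ k ω)‖ ^ 2 + M ^ 2) P := fun k hk =>
    (hg2 k hk).add (integrable_const _)
  have hF1 : ∀ k ∈ Finset.Icc 1 K, Integrable (fun ω => F (x k ω)) P := fun k hk =>
    h.integrable_loss_iterate hK (hk1 k hk)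
  have hF2 : ∀ k ∈ Finset.Icc 1 K, Integrable (fun ω => F (x (k - d k ω) ω)) P := fun k hk =>
    (h.integral_loss_delayed (Finset.mem_Icc.1 hk)).1
  have hw1 : ∀ k ∈ Finset.Icc 1 K, Integrable (fun ω => ‖x k ω - x (k - d k ω) ω‖) P :=
    fun k hk => (h.delay_le (Finset.mem_Icc.1 hk)).1
  have hw2 : ∀ k ∈ Finset.Icc 1 K, Integrable (fun ω => ‖x k ω - x (k - d k ω) ω‖ ^ 2) P :=
    fun k hk => (h.sq_delay_le (Finset.mem_Icc.1 hk)).1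
  have hN := fun k (hk : k ∈ Finset.Icc 1 K) => h.integral_noise (Finset.mem_Icc.1 hk) hlip
  set N : ℕ → Ω → ℝ := fun k ω => inner ℝ (x k ω - pr (x k ω))
      (∫ e, g k (x (k - d k ω) ω) e ∂μ - g k (x (k - d k ω) ω) (ξ k ω)) with hNdef
  have hI2 : ∀ k ∈ Finset.Icc 1 K,
      Integrable (fun ω => F (x k ω) - F (x (k - d k ω) ω)) P :=
    fun k hk => (hF1 k hk).sub (hF2 k hk)
  have hI3 : ∀ k ∈ Finset.Icc 1 K, Integrable (fun ω => F (x k ω) - F (x (k - d k ω) ω)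
      + M * ‖x k ω - x (k - d k ω) ω‖) P :=
    fun k hk => (hI2 k hk).add ((hw1 k hk).const_mul M)
  have hI4 : ∀ k ∈ Finset.Icc 1 K, Integrable (fun ω => F (x k ω) - F (x (k - d k ω) ω)
      + M * ‖x k ω - x (k - d k ω) ω‖ + c₄ * ‖x k ω - x (k - d k ω) ω‖ ^ 2) P :=
    fun k hk => (hI3 k hk).add ((hw2 k hk).const_mul c₄)
  have hI5 : ∀ k ∈ Finset.Icc 1 K, Integrable (fun ω => F (x k ω) - F (x (k - d k ω) ω)
      + M * ‖x k ω - x (k - d k ω) ω‖ + c₄ * ‖x k ω - x (k - d k ω) ω‖ ^ 2 + N k ω) P :=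
    fun k hk => (hI4 k hk).add (hN k hk).1
  have hI6 : ∀ k ∈ Finset.Icc 1 K, Integrable (fun ω => c₁ * (b ^ 2 * ‖x k ω - x (k - 1) ω‖ ^ 2)
      + 4 * a ^ 2 * (‖g k (x (k - d k ω) ω) (ξ k ω)‖ ^ 2 + M ^ 2)) P :=
    fun k hk => (((hD k hk).const_mul _).const_mul _).add
      ((hg3 k hk).const_mul _)
  have key := sum_integral_le_of_telescope (P := P) (K := K)
    (pot := fun k ω => moreauEnvelope (1 / ρ') (objective F r) (x k ω))
    (s := fun k ω => ρ' / 2 * (a * (ρ' - ρ)) * ‖x k ω - pr (x k ω)‖ ^ 2)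
    (m := fun k ω => ρ' / 2 * (c₁ * (b ^ 2 * ‖x k ω - x (k - 1) ω‖ ^ 2)
      + 4 * a ^ 2 * (‖g k (x (k - d k ω) ω) (ξ k ω)‖ ^ 2 + M ^ 2)
      + c₃ * (F (x k ω) - F (x (k - d k ω) ω) + M * ‖x k ω - x (k - d k ω) ω‖
        + c₄ * ‖x k ω - x (k - d k ω) ω‖ ^ 2 + N k ω)))
    (c := moreauEnvelope (1 / ρ') (objective F r) x₀)
    (c' := (optValue (objective F r)).toReal)
    (fun k hk => (hU k hk).const_mul _)
    (fun k hk => ((hI6 k hk).add ((hI5 k hk).const_mul c₃)).const_mul _)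
    (fun k hk ω => by
      have hk' : k ∈ Set.Icc 1 K := Finset.mem_Icc.1 hk
      -- The mean of the first oracle serves as the selection `G`; `v` is the mean of the k-th
      -- oracle at the delayed point, which makes the inner-product term centred noise.
      exact moreauEnvelope_step_le h.weaklyConvex h.closedConvex (h.oracle_mean_mem 1 h1K)
        (fun y hy => h.norm_oracle_mean_le h1K hy) hρ' ha haρ
        (h.iterates.mem_effDom (hk1 k hk) ω)
        (h.oracle_mean_mem k hk' _ (h.delayed_mem_effDom hk' ω))
        (h.norm_oracle_mean_le hk' (h.delayed_mem_effDom hk' ω))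
        (h.iterates.step k hk' ω) (hpr _) (hpr _))
    (fun ω => by rw [h.iterates.one])
    (fun ω => by
      rw [(hpr (x (K + 1) ω)).moreauEnvelope_eq hbot ⟨x₀, hx₀⟩]
      have h1 := toReal_optValue_le hbdd ((hpr (x (K + 1) ω)).mem_effDom hx₀)
      have h2 : 0 ≤ 1 / (2 * (1 / ρ')) * ‖pr (x (K + 1) ω) - x (K + 1) ω‖ ^ 2 := by positivity
      linarith)
  have hm : ∀ k ∈ Finset.Icc 1 K,
      ∫ ω, ρ' / 2 * (c₁ * (b ^ 2 * ‖x k ω - x (k - 1) ω‖ ^ 2)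
      + 4 * a ^ 2 * (‖g k (x (k - d k ω) ω) (ξ k ω)‖ ^ 2 + M ^ 2)
      + c₃ * (F (x k ω) - F (x (k - d k ω) ω) + M * ‖x k ω - x (k - d k ω) ω‖
        + c₄ * ‖x k ω - x (k - d k ω) ω‖ ^ 2 + N k ω)) ∂P ≤
      ρ' / 2 * (c₁ * (b ^ 2 * ∫ ω, ‖x k ω - x (k - 1) ω‖ ^ 2 ∂P) + 4 * a ^ 2 * (M ^ 2 + M ^ 2)
        + c₃ * ((∫ ω, F (x k ω) ∂P - ∫ ω, F (x (k - d k ω) ω) ∂P)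
          + M * ∫ ω, ‖x k ω - x (k - d k ω) ω‖ ∂P
          + c₄ * ∫ ω, ‖x k ω - x (k - d k ω) ω‖ ^ 2 ∂P)) := fun k hk => by
    rw [integral_const_mul, integral_add (hI6 k hk) ((hI5 k hk).const_mul c₃),
      integral_const_mul c₃, integral_add (hI4 k hk) (hN k hk).1, (hN k hk).2, add_zero,
      integral_add (hI3 k hk) ((hw2 k hk).const_mul c₄), integral_const_mul c₄,
      integral_add (hI2 k hk) ((hw1 k hk).const_mul M), integral_const_mul M,
      integral_sub (hF1 k hk) (hF2 k hk),
      integral_add (((hD k hk).const_mul _).const_mul _)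
        ((hg3 k hk).const_mul _),
      integral_const_mul c₁, integral_const_mul (b ^ 2), integral_const_mul (4 * a ^ 2),
      integral_add (hg2 k hk) (integrable_const _)]
    simp only [integral_const, probReal_univ, one_smul]
    have h1 := (h.sample_subgradient_memLp (Finset.mem_Icc.1 hk)).2
    have h2 : 4 * a ^ 2 * (∫ ω, ‖g k (x (k - d k ω) ω) (ξ k ω)‖ ^ 2 ∂P + M ^ 2) ≤
        4 * a ^ 2 * (M ^ 2 + M ^ 2) :=
      mul_le_mul_of_nonneg_left (by linarith) (by positivity)
    exact mul_le_mul_of_nonneg_left (by linarith) (by positivity)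
  have h2 := key.trans (add_le_add_right (Finset.sum_le_sum hm) _)
  simp only [integral_const_mul] at h2
  simp only [Finset.sum_add_distrib, ← Finset.mul_sum] at h2
  simp only [Finset.sum_const, Nat.card_Icc, Nat.add_sub_cancel, nsmul_eq_mul] at h2
  refine h2.trans ?_
  have e1 := mul_le_mul_of_nonneg_left hB (mul_nonneg hc₁0 (sq_nonneg b))
  have e2 := h.sum_loss_sub_delayed_le hK hC
  have e3 := mul_le_mul_of_nonneg_left (h.sum_delay_le hB) hM
  have e4 := mul_le_mul_of_nonneg_left (h.sum_sq_delay_le hB) hc₄0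
  have hB0 : 0 ≤ B := le_trans (Finset.sum_nonneg fun k _ =>
    integral_nonneg fun ω => by positivity) hB
  have hCF : 0 ≤ C - F x₀ := sub_nonneg.2 (hC _ h.iterates.start_mem)
  -- The factor c₃ is enlarged to 2a only after summation: single loss differences may be negative,
  -- but the summed bound is not.
  have e5 : 0 ≤ τ * (C - F x₀) + M * (τ * (√K * √B)) + c₄ * (τ * (τ * B)) := by positivity
  have e6 := mul_le_mul_of_nonneg_left (add_le_add (add_le_add e2 e3) e4) hc₃0
  have e7 := mul_le_mul_of_nonneg_right hc₃a e5
  have e8 := mul_le_mul_of_nonneg_left (add_le_add e1 (e6.trans e7))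
    (show 0 ≤ ρ' / 2 by positivity)
  linarith

end IsInertialRun

/-! ### Asymptotics of the bound. -/

section Rate

theorem tendsto_sqrt_natCast_atTop : Tendsto (fun N : ℕ => √(N : ℝ)) atTop atTop :=
  Real.tendsto_sqrt_atTop.comp tendsto_natCast_atTop_atTop

theorem tendsto_gam (ρ α β : ℝ) : Tendsto (gam ρ α β) atTop (𝓝 (1 / 2)) := by
  have h1 : Tendsto (fun N : ℕ => α * ρ / (2 * √(N : ℝ))) atTop (𝓝 0) :=
    (tendsto_sqrt_natCast_atTop.const_mul_atTop two_pos).const_div_atTop _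
  have h2 : Tendsto (fun N : ℕ => β / (N : ℝ) ^ (1 / 4 : ℝ)) atTop (𝓝 0) :=
    ((tendsto_rpow_atTop (by norm_num : (0 : ℝ) < 1 / 4)).comp
      tendsto_natCast_atTop_atTop).const_div_atTop _
  have h3 := ((h1.const_sub 1).sub h2).const_mul (1 / 2)
  rw [sub_zero, sub_zero, mul_one] at h3
  exact h3

theorem tendsto_moveBound (ρ α β M φ₁ φs : ℝ) :
    Tendsto (moveBound ρ α β M φ₁ φs) atTop (𝓝 (α ^ 2 * M ^ 2 / (1 / 2) ^ 2)) := by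
  have hg := tendsto_gam ρ α β
  have h1 : Tendsto (fun N : ℕ => gam ρ α β N * √(N : ℝ)) atTop atTop :=
    hg.pos_mul_atTop (by norm_num) tendsto_sqrt_natCast_atTop
  have h2 := ((h1.const_div_atTop α).mul_const (φ₁ - φs)).add
    (tendsto_const_nhds (x := α ^ 2 * M ^ 2) |>.div (hg.pow 2) (by norm_num))
  rw [zero_mul, zero_add] at h2
  exact h2

/-- The bracket converges, since γ → 1/2 makes B converge and the √N in the inertia coefficient
cancels against β²/√N. The prefactor is a constant over √N. -/
theorem isBigO_rateBound {ρ ρ' α : ℝ} (β M CF : ℝ) (τ : ℕ) (F₁ φ₁ e₁ φs : ℝ) (hα : 0 < α)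
    (hρ' : ρ < ρ') :
    (fun N : ℕ => rateBound ρ ρ' α β M CF τ F₁ φ₁ e₁ φs N) =O[atTop]
      fun N : ℕ => 1 / √(N : ℝ) := by
  have hB := tendsto_moveBound ρ α β M φ₁ φs
  have hs := tendsto_sqrt_natCast_atTop
  have hs0 : 0 < ρ' - ρ := by linarith
  have h1 : Tendsto (fun N : ℕ => (2 + 2 * √(N : ℝ) / (α * (ρ' - ρ))) * (β ^ 2 / √(N : ℝ))) atTop
      (𝓝 (0 + 2 * β ^ 2 / (α * (ρ' - ρ)))) := by
    have h2 : Tendsto (fun N : ℕ => 2 * β ^ 2 / √(N : ℝ) + 2 * β ^ 2 / (α * (ρ' - ρ))) atTop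
        (𝓝 (0 + 2 * β ^ 2 / (α * (ρ' - ρ)))) := (hs.const_div_atTop _).add_const _
    refine h2.congr' ?_
    filter_upwards [hs.eventually_gt_atTop 0] with N hN
    field_simp
  have h3 : Tendsto (fun N : ℕ => α * ρ' * τ / √(N : ℝ) * (max 0 (-F₁) + CF
      + τ * (ρ / 2 + ρ ^ 2 / (ρ' - ρ)) * moveBound ρ α β M φ₁ φs N)) atTop (𝓝 _) :=
    (hs.const_div_atTop _).mul ((hB.const_mul _).const_add _)
  have h4 := (((((h1.const_mul (ρ' / 2)).mul hB).add_const (4 * ρ' * M ^ 2 * α ^ 2)).add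
    h3).add_const (e₁ - φs)).add (hB.sqrt.const_mul (M * α * ρ' * τ))
  have h5 : (fun N : ℕ => 2 * ρ' / ((ρ' - ρ) * α * √(N : ℝ))) =O[atTop]
      fun N : ℕ => 1 / √(N : ℝ) := by
    refine IsBigO.of_bound |2 * ρ' / ((ρ' - ρ) * α)| (Eventually.of_forall fun N => le_of_eq ?_)
    rw [← Real.norm_eq_abs, ← norm_mul]
    rw [div_mul_div_comm, mul_one]
  have h6 := h5.mul (h4.isBigO_one ℝ)
  simp only [mul_one] at h6
  refine h6.congr_left fun N => ?_
  rw [rateBound]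
  ring

end Rate

/-- On dom r one has r = φ - F ≥ φ* - C_F. This lower bound yields existence of the proximal points
of `r`. -/
theorem exists_bddBelow_of_objective {n : ℕ} {F : Vec n → ℝ} {r : Vec n → EReal}
    (hr : ∀ x, r x ≠ ⊥) (hbdd : optValue (objective F r) ≠ ⊥) {C : ℝ}
    (hC : ∀ y ∈ effDom r, F y ≤ C) : ∃ m : ℝ, ∀ y, (m : EReal) ≤ r y := by
  refine ⟨(optValue (objective F r)).toReal - C, fun y => ?_⟩
  by_cases hy : y ∈ effDom r
  · have h1 := toReal_optValue_le hbdd (x := y) (by rwa [effDom_objective])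
    rw [toReal_objective F hr hy] at h1
    rw [← coe_toReal_of_mem_effDom hr hy, EReal.coe_le_coe_iff]
    linarith [hC y hy]
  · have : r y = ⊤ := by simpa [effDom] using hy
    rw [this]
    exact le_top

end InertialSubgradient

end

/-! ### Assembly of the rate. -/

theorem mainTheorem1 {n : ℕ} {Ξ Ω : Type*} [MeasurableSpace Ξ] [MeasurableSpace Ω]
    (P : Measure Ω) [IsProbabilityMeasure P] (μ : Measure Ξ) [IsProbabilityMeasure μ]
    -- the problem: `F = E f(·; ξ)` is weakly convex, `r` is closed convex, `φ = F + r`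
    (f : Vec n → Ξ → ℝ) (r : Vec n → EReal) (F : Vec n → ℝ) (φ : Vec n → EReal)
    (hf : ∀ x, Integrable (f x) μ) (hF : F = expectedLoss f μ) (hφ : φ = objective F r)
    (hr : ClosedConvex r) (hφbdd : optValue φ ≠ ⊥)
    (ρ : ℝ) (hweak : WeaklyConvex ρ F)
    (C_F : ℝ) (hCF : ∀ x ∈ effDom r, F x ≤ C_F)
    -- parameters
    (K : ℕ) (hK : 1 ≤ K) (ρ' : ℝ) (hρ' : ρ' ∈ Set.Ioc ρ (2 * ρ))
    (α β : ℝ) (hα : 0 < α) (hβ : 0 ≤ β)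
    (hαK : α / √(K : ℝ) ≤ 1 / ρ')
    (hβK : β / (K : ℝ) ^ (1 / 4 : ℝ) < 1 - α * ρ / (2 * √(K : ℝ)))
    (a b : ℕ → ℝ) (ha : ∀ k ∈ Set.Icc 1 K, a k = α / √(K : ℝ))
    (hb : ∀ k ∈ Set.Icc 1 K, b k = β / (K : ℝ) ^ (1 / 4 : ℝ))
    -- unbiased sample subgradients with bounded second moment
    (g : ℕ → Vec n → Ξ → Vec n) (M : ℝ) (hM : 0 ≤ M)
    (hg : ∀ k ∈ Set.Icc 1 K, IsSubgradientOracle f r μ (g k))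
    (hunb : ∀ k ∈ Set.Icc 1 K, Unbiased f r μ (g k))
    (hbound : BoundedSubgradients f r μ M)
    -- samples, delays, the iterates, and the random output index
    (ξ : ℕ → Ω → Ξ) (d : ℕ → Ω → ℕ) (τ : ℕ) (p : ℕ → ℝ)
    (hsamp : IsSampling P μ τ p K ξ d)
    (x₀ : Vec n) (x : ℕ → Ω → Vec n)
    (hx : IsIterateSequence r g a b ξ d K x₀ x)
    (T : Ω → ℕ) (hT : IsRandomIndex P a K ξ d T) :
    Differentiable ℝ (moreauEnvelope (1 / ρ') φ) ∧
    Integrable (fun ω => ‖gradient (moreauEnvelope (1 / ρ') φ) (x (T ω) ω)‖ ^ 2) P ∧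
    ∫ ω, ‖gradient (moreauEnvelope (1 / ρ') φ) (x (T ω) ω)‖ ^ 2 ∂P ≤
      rateBound ρ ρ' α β M C_F τ (F x₀) (φ x₀).toReal (moreauEnvelope (1 / ρ') φ x₀)
        (optValue φ).toReal K ∧
    (fun N : ℕ => rateBound ρ ρ' α β M C_F τ (F x₀) (φ x₀).toReal
        (moreauEnvelope (1 / ρ') φ x₀) (optValue φ).toReal N)
      =O[atTop] (fun N : ℕ => 1 / √(N : ℝ)) := by
  subst hφ
  obtain ⟨hρρ', -⟩ := hρ'
  have hρ := hweak.1
  have hρ'0 : 0 < ρ' := hρ.trans hρρ'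
  have hs0 : 0 < ρ' - ρ := by linarith
  have hbot := objective_ne_bot F hr.ne_bot
  have hKpos : (0 : ℝ) < K := by exact_mod_cast hK
  have hsq : 0 < √(K : ℝ) := Real.sqrt_pos.2 hKpos
  have hsqsq : √(K : ℝ) ^ 2 = K := Real.sq_sqrt hKpos.le
  have hx₀ : x₀ ∈ effDom (objective F r) := by
    rw [effDom_objective]
    exact hx.start_mem
  have hconv := segmentWeaklyConvex_objective hweak hr
  have hlρ : ρ < 1 / (1 / ρ') := by rwa [one_div_one_div]
  obtain ⟨L, pr, hlip, hpr, -⟩ := exists_lipschitz_proxMap (c := 1 / ρ')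
    (lowerSemicontinuous_objective hweak.continuous hr.lsc)
    (fun y => (coe_toReal_optValue hφbdd ⟨x₀, hx₀⟩).le.trans (iInf_le _ y)) ⟨x₀, hx₀⟩ hconv
    (one_div_pos.2 hρ'0) hlρ
  have hgrad := hasGradientAt_moreauEnvelope hbot hconv ⟨x₀, hx₀⟩ (one_div_pos.2 hρ'0) hlρ hpr
  have hnorm : ∀ y, ‖gradient (moreauEnvelope (1 / ρ') (objective F r)) y‖ ^ 2 =
      ρ' ^ 2 * ‖y - pr y‖ ^ 2 := fun y => by
    rw [(hgrad y).gradient, norm_smul, mul_pow, one_div_one_div, Real.norm_eq_abs, sq_abs]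
  obtain ⟨A, hA⟩ : ∃ A, A = α / √(K : ℝ) := ⟨_, rfl⟩
  obtain ⟨b', hb'⟩ : ∃ b', b' = β / (K : ℝ) ^ (1 / 4 : ℝ) := ⟨_, rfl⟩
  have hA0 : 0 < A := hA ▸ div_pos hα hsq
  have hAρ : A * ρ' ≤ 1 := by
    rw [← hA] at hαK
    rwa [le_div_iff₀ hρ'0] at hαK
  have hAα : A * √(K : ℝ) = α := by rw [hA]; field_simp
  have hrun : IsInertialRun P μ F r ρ M A b' g ξ d τ p K x₀ x :=
    { weaklyConvex := hweak
      closedConvex := hr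
      bddBelow := exists_bddBelow_of_objective hr.ne_bot hφbdd hCF
      step_pos := hA0
      bound_nonneg := hM
      oracle_measurable := fun k hk => (hg k hk).measurable
      oracle_sq_le := fun k hk y hy => hbound y hy (g k y)
        ((hg k hk).measurable.comp measurable_prodMk_left) ((hg k hk).mem_subdiff y hy)
      oracle_mean_mem := fun k hk y hy => by
        rw [hF]
        exact hunb k hk y hy
      sampling := hsamp
      iterates :=
        { start_mem := hx.start_mem
          zero := hx.zero
          one := hx.one
          step := fun k hk ω => by
            have h1 := hx.step k hk ω
            rwa [ha k hk, hb k hk, ← hA, ← hb'] at h1 } }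
  have hb0 : 0 ≤ b' := by rw [hb']; positivity
  have hAρ2 : α * ρ / (2 * √(K : ℝ)) = A * ρ / 2 := by rw [hA]; field_simp
  obtain ⟨γ, hγ⟩ : ∃ γ, γ = gam ρ α β K := ⟨_, rfl⟩
  have hγ2 : 2 * γ = 1 - A * ρ / 2 - b' := by
    rw [hγ, gam, hAρ2, ← hb']
    ring
  have hγ0 : 0 < γ := by
    rw [← hb', hAρ2] at hβK
    linarith
  have hb2 : b' ^ 2 = β ^ 2 / √(K : ℝ) := by
    rw [hb', div_pow, ← Real.rpow_natCast, ← Real.rpow_natCast, ← Real.rpow_mul hKpos.le,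
      Real.sqrt_eq_rpow]
    norm_num
  obtain ⟨B, hBdef⟩ : ∃ B, B = moveBound ρ α β M (objective F r x₀).toReal
      (optValue (objective F r)).toReal K := ⟨_, rfl⟩
  have hB := hrun.sum_increment_le hK hφbdd hb0 hγ0 hγ2
  have hBeq : A / γ * ((objective F r x₀).toReal - (optValue (objective F r)).toReal)
      + K * A ^ 2 * M ^ 2 / γ ^ 2 = B := by
    rw [hBdef, moveBound, ← hγ]
    congr 1
    · rw [hA, div_div, mul_comm γ]
    · rw [← hAα, mul_pow, hsqsq, mul_comm (A ^ 2)]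
  rw [hBeq] at hB
  have hres := hrun.sum_sq_residual_le hK hφbdd hCF hρρ' hAρ hB hlip hpr
  -- Constant stepsizes make T uniform.
  have hTlaw : ∀ k ∈ Finset.Icc 1 K, P.real {ω | T ω = k} = 1 / K := fun k hk => by
    rw [hT.law k (Finset.mem_Icc.1 hk),
      Finset.sum_congr rfl fun j hj => ha j (Finset.mem_Icc.1 hj), ha k (Finset.mem_Icc.1 hk),
      ← hA]
    simp only [Finset.sum_const, Nat.card_Icc, Nat.add_sub_cancel, nsmul_eq_mul]
    field_simp
  have hTsum : ∑ k ∈ Finset.Icc 1 K, P.real {ω | T ω = k} = 1 := by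
    rw [Finset.sum_congr rfl hTlaw]
    simp only [Finset.sum_const, Nat.card_Icc, Nat.add_sub_cancel, nsmul_eq_mul]
    field_simp
  have hk1 : ∀ k ∈ Finset.Icc 1 K, k ≤ K + 1 := fun k hk =>
    (Finset.mem_Icc.1 hk).2.trans (Nat.le_succ K)
  have hTint := integral_comp_random_index hT.measurable (Finset.Icc 1 K) hTsum
    (Φ := fun k ω => ρ' ^ 2 * ‖x k ω - pr (x k ω)‖ ^ 2)
    (fun k hk => (((hrun.iterate_memLp (hk1 k hk)).sub
      (memLp_lipschitz_comp hlip (hrun.iterate_memLp (hk1 k hk)))).norm.integrable_sq).const_mul _)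
    (fun k hk => by
      have h1 := hT.indepFun_iterate (hrun.measurable_iterate_past (hk1 k hk) le_rfl)
      have h2 : Measurable fun y : Vec n => ρ' ^ 2 * ‖y - pr y‖ ^ 2 :=
        (continuous_const.mul ((continuous_id.sub hlip.continuous).norm.pow 2)).measurable
      exact h1.comp measurable_id h2)
  refine ⟨fun y => (hgrad y).differentiableAt, ?_, ?_, ?_⟩
  · simp_rw [hnorm]
    exact hTint.1
  · simp_rw [hnorm]
    rw [hTint.2, Finset.sum_congr rfl fun k hk => by rw [hTlaw k hk, integral_const_mul],
      ← Finset.mul_sum, ← Finset.mul_sum]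
    set S := ∑ k ∈ Finset.Icc 1 K, ∫ ω, ‖x k ω - pr (x k ω)‖ ^ 2 ∂P
    rw [rateBound, ← hBdef]
    have hmax : C_F - F x₀ ≤ max 0 (-F x₀) + C_F := by linarith [le_max_right 0 (-F x₀)]
    have hcoef : 0 ≤ A * ρ' * τ := by positivity
    have hstep := mul_le_mul_of_nonneg_left (add_le_add_left hmax
      (τ * (ρ / 2 + ρ ^ 2 / (ρ' - ρ)) * B)) hcoef
    have e1 : 2 * √(K : ℝ) / (α * (ρ' - ρ)) = 2 / (A * (ρ' - ρ)) := by
      rw [hA]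
      field_simp
    have e2 : α * ρ' * τ / √(K : ℝ) = A * ρ' * τ := by
      rw [hA]
      ring
    have e3 : α ^ 2 = K * A ^ 2 := by
      rw [← hAα, mul_pow, hsqsq, mul_comm]
    -- Since α√K = AK, the prefactor is ρ'²/K divided by the coefficient (ρ'/2)A(ρ' - ρ) of the
    -- summed residuals in `hres`.
    have e4 : 2 * ρ' / ((ρ' - ρ) * α * √(K : ℝ)) = 2 * ρ' / ((ρ' - ρ) * A * K) := by
      congr 1
      calc (ρ' - ρ) * α * √(K : ℝ) = (ρ' - ρ) * A * √(K : ℝ) ^ 2 := by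
            rw [← hAα]
            ring
        _ = _ := by rw [hsqsq]
    have e5 : 1 / (K : ℝ) * (ρ' ^ 2 * S) =
        2 * ρ' / ((ρ' - ρ) * A * K) * (ρ' / 2 * (A * (ρ' - ρ)) * S) := by
      field_simp
    have e6 : M * α * ρ' * τ * √B = M * A * ρ' * τ * (√(K : ℝ) * √B) := by
      rw [← hAα]
      ring
    rw [e1, e2, e3, e4, e5, e6, ← hb2]
    refine mul_le_mul_of_nonneg_left ?_ (by positivity)
    linarith
  · exact isBigO_rateBound β M C_F τ (F x₀) _ _ _ hα hρρ'
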